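/- **Theorem 1.** There is a universal constant $C>0$ such that the following holds for every integer $n\ge 1$. Let $K\subset\mathbb R^n$ be a centrally symmetric convex body (compact, convex, $K=-K$, non-empty interior) with $\mathrm{Vol}(K)=\mathrm{Vol}(D_n)$, where $D_n$ is the Euclidean unit ball, and suppose that $K$ is in isotropic position, i.e. $\int_K\langle x,\theta\rangle^2\,dx$ is the same for all $\theta\in S^{n-1}$. Then $$L_K\;\le\; C\,\inf\left\{\frac{\sqrt{p_0}}{M_p(L)}\;:\; p\ge 0,\ L\in SL_p^n,\ K\subset L\right\},\qquad p_0=\max(1,\min(p,n)).$$ Here: - $L_K\ge 0$ is the isotropic constant of $K$: the number with $\int_{TK}\langle x,\theta\rangle^2dx=L_K^2$ for all $\theta\in S^{n-1}$, where $T$ is an invertible linear map such that $TK$ has volume $1$ and is in isotropic position ($L_K$ does not depend on the choice of $T$). - For real $p>0$, $SL_p^n$ is the class of unit balls of $n$-dimensional subspaces of $L_p([0,1])$, i.e. of sets $L=\{x\in\mathbb R^n:\|Tx\|_{L_p}\le 1\}$ with $T:\mathbb R^n\to L_p([0,1])$ linear and injective, where $\|f\|_{L_p}=(\int_0^1|f|^p)^{1/p}$.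 - $SL_0^n$ is the class of star bodies $L\subset\mathbb R^n$ (sets with $tL\subset L$ for all $t\in[0,1]$ whose radial function $\rho_L(\theta)=\max\{r\ge0: r\theta\in L\}$ is well defined and continuous on $S^{n-1}$) for which there are a Borel probability measure $\mu$ on $S^{n-1}$ and a constant $c\in\mathbb R$ with $$\|x\|_L=\exp\left(\int_{S^{n-1}}\log|\langle x,\theta\rangle|\,d\mu(\theta)+c\right)\qquad\text{for all }x\in\mathbb R^n .$$ - $\|x\|_L=\inf\{t>0: x\in tL\}$ is the Minkowski functional of $L$, and, with $\sigma$ the rotation invariant probability measure on $S^{n-1}$, $$M_p(L)=\left(\int_{S^{n-1}}\|\theta\|_L^p\,d\sigma(\theta)\right)^{1/p}\ (p>0),\qquad M_0(L)=\exp\left(\int_{S^{n-1}}\log\|\theta\|_L\,d\sigma(\theta)\right).$$ -/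

import Mathlib

open MeasureTheory Set

open scoped RealInnerProductSpace

noncomputable section

namespace Slicing

/-- Euclidean space of dimension `n`, with its standard inner product and Lebesgue measure. -/
abbrev E (n : ℕ) : Type := EuclideanSpace ℝ (Fin n)

/-- `K` is in isotropic position: the second moment `∫_K ⟨x, θ⟩² dx` does not depend on the
unit vector `θ`. -/
def IsIsotropicPosition {n : ℕ} (K : Set (E n)) : Prop :=
  ∃ c : ℝ, ∀ θ : E n, ‖θ‖ = 1 → ∫ x in K, ⟪x, θ⟫ ^ 2 = c

/-- The numbers `ℓ ≥ 0` such that some linear image `T K` of volume one satisfies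
`∫_{T K} ⟨x, θ⟩² dx = ℓ²` for all unit vectors `θ`. -/
def isotropicConstants {n : ℕ} (K : Set (E n)) : Set ℝ :=
  {ℓ | 0 ≤ ℓ ∧ ∃ T : E n ≃ₗ[ℝ] E n, volume (T '' K) = 1 ∧
    ∀ θ : E n, ‖θ‖ = 1 → ∫ x in T '' K, ⟪x, θ⟫ ^ 2 = ℓ ^ 2}

/-- The isotropic constant `L_K` of a centrally symmetric convex body `K` in dimension `n ≥ 1`:
the isotropic constant of an isotropic position of `K` of volume one. Such a position exists and
is unique up to rotations, so `isotropicConstants K` has exactly one element, which is what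
`sInf` selects. -/
def isotropicConstant {n : ℕ} (K : Set (E n)) : ℝ :=
  sInf (isotropicConstants K)

/-- Star bodies: sets star-shaped about the origin whose radial function
`ρ(θ) = max {r ≥ 0 | r θ ∈ L}` exists and is continuous on the unit sphere. -/
def IsStarBody {n : ℕ} (L : Set (E n)) : Prop :=
  (∀ t : ℝ, 0 ≤ t → t ≤ 1 → ∀ x ∈ L, t • x ∈ L) ∧
    ∃ ρ : Metric.sphere (0 : E n) 1 → ℝ, Continuous ρ ∧
      ∀ θ : Metric.sphere (0 : E n) 1, IsGreatest {r : ℝ | 0 ≤ r ∧ r • (θ : E n) ∈ L} (ρ θ)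

/-- The space `L_p = L_p([0,1], dx)` for real `p > 0`; its `Norm` is `(∫ |f|^p)^(1/p)`, which for
`p < 1` is only a quasi-norm. -/
abbrev LpUnit (p : ℝ) : Type :=
  Lp ℝ (ENNReal.ofReal p) (volume.restrict (Icc (0 : ℝ) 1))

/-- For `p > 0`: `L` is the unit ball of an `n`-dimensional linear subspace of `L_p([0,1])`, the
subspace being identified with `ℝⁿ` through a linear injection `T`. -/
def IsSectionPos {n : ℕ} (p : ℝ) (L : Set (E n)) : Prop :=
  ∃ T : E n →ₗ[ℝ] LpUnit p, Function.Injective T ∧ L = {x | ‖T x‖ ≤ 1}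

/-- The limiting case `p = 0`: `L` is a star body whose Minkowski functional is
`‖x‖_L = exp (∫ log |⟨x, θ⟩| dμ(θ) + c)` for a Borel probability measure `μ` on the unit sphere
and a constant `c`. As `‖x‖_L > 0` for `x ≠ 0`, the integral has to be finite, where
`log 0 = -∞`: this is what the first two clauses say (Lean's convention is `log 0 = 0`). At `x = 0`
both sides are zero, as `exp (-∞) = 0`. -/
def IsSectionZero {n : ℕ} (L : Set (E n)) : Prop :=
  IsStarBody L ∧
    ∃ (μ : Measure (Metric.sphere (0 : E n) 1)) (c : ℝ), IsProbabilityMeasure μ ∧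
      ∀ x : E n, x ≠ 0 →
        (∀ᵐ θ : Metric.sphere (0 : E n) 1 ∂μ, ⟪x, (θ : E n)⟫ ≠ 0) ∧
        Integrable (fun θ : Metric.sphere (0 : E n) 1 => Real.log |⟪x, (θ : E n)⟫|) μ ∧
        gauge L x = Real.exp ((∫ θ : Metric.sphere (0 : E n) 1, Real.log |⟪x, (θ : E n)⟫| ∂μ) + c)

/-- The class `SL_p^n` of unit balls of `n`-dimensional subspaces of `L_p`, for `p ≥ 0`. -/
def IsSection {n : ℕ} (p : ℝ) (L : Set (E n)) : Prop :=
  (0 < p ∧ IsSectionPos p L) ∨ (p = 0 ∧ IsSectionZero L)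

/-- The rotation invariant probability measure on the unit sphere. -/
def sphereProb (n : ℕ) : Measure (Metric.sphere (0 : E n) 1) :=
  ((volume : Measure (E n)).toSphere univ)⁻¹ • (volume : Measure (E n)).toSphere

/-- The `p`-th mean-norm `M_p(L)`, where `gauge L` is the Minkowski functional of `L`. -/
def meanNorm {n : ℕ} (p : ℝ) (L : Set (E n)) : ℝ :=
  if p = 0 then
    Real.exp (∫ θ : Metric.sphere (0 : E n) 1, Real.log (gauge L (θ : E n)) ∂(sphereProb n))
  else
    (∫ θ : Metric.sphere (0 : E n) 1, gauge L (θ : E n) ^ p ∂(sphereProb n)) ^ (1 / p)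

/-- The set of all numbers `√p₀ / M_p(L)` with `p ≥ 0`, `L ∈ SL_p^n` and `K ⊆ L`, where
`p₀ = max(1, min(p, n))`. It consists of positive numbers, and it is not empty when `K` is bounded:
balls belong to `SL_2^n`. -/
def sectionBounds {n : ℕ} (K : Set (E n)) : Set ℝ :=
  {r | ∃ (p : ℝ) (L : Set (E n)), 0 ≤ p ∧ IsSection p L ∧ K ⊆ L ∧
    r = √(max 1 (min p (n : ℝ))) / meanNorm p L}

end Slicing

end

noncomputable section

namespace Slicing

open scoped ENNReal NNReal Pointwise

/-! ### The midpoint Prékopa–Leindler inequality -/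

/-- One-dimensional Brunn–Minkowski inequality for compact sets. -/
theorem volume_add_le_of_isCompact {A B C : Set ℝ} (hA : IsCompact A) (hB : IsCompact B)
    (hA' : A.Nonempty) (hB' : B.Nonempty) (h : ∀ a ∈ A, ∀ b ∈ B, a + b ∈ C) :
    volume A + volume B ≤ volume C := by
  obtain ⟨a, ha, ha'⟩ := hA.exists_isGreatest hA'
  obtain ⟨b, hb, hb'⟩ := hB.exists_isLeast hB'
  have h1 : volume ((fun x => x + b) '' A) = volume A := by
    simp [measure_preimage_add_right]
  have h2 : volume ((fun x => a + x) '' B) = volume B := by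
    simp [measure_preimage_add]
  have hAm : MeasurableSet ((fun x => a + x) '' B) :=
    (hB.image (by fun_prop)).measurableSet
  have hd : AEDisjoint volume ((fun x => x + b) '' A) ((fun x => a + x) '' B) := by
    refine measure_mono_null (t := {a + b}) ?_ (by simp)
    rintro _ ⟨⟨x, hx, rfl⟩, ⟨y, hy, hxy⟩⟩
    have := ha' hx
    have := hb' hy
    simp only at hxy
    rw [mem_singleton_iff]
    linarith
  rw [← h1, ← h2, ← measure_union₀ hAm.nullMeasurableSet hd]
  refine measure_mono ?_
  rintro _ (⟨x, hx, rfl⟩ | ⟨y, hy, rfl⟩)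
  · exact h x hx b hb
  · exact h a ha y hy

theorem volume_add_le_two_mul_of_midpoint_mem {A B C : Set ℝ} (hA : MeasurableSet A)
    (hB : MeasurableSet B) (hA' : A.Nonempty) (hB' : B.Nonempty)
    (h : ∀ a ∈ A, ∀ b ∈ B, midpoint ℝ a b ∈ C) :
    volume A + volume B ≤ 2 * volume C := by
  have key : ∀ A' ⊆ A, IsCompact A' → ∀ B' ⊆ B, IsCompact B' →
      volume A' + volume B' ≤ 2 * volume C := by
    intro A' hAA cA B' hBB cB
    obtain ⟨a, ha⟩ := hA'
    obtain ⟨b, hb⟩ := hB'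
    have := volume_add_le_of_isCompact (A := insert a A') (B := insert b B')
      (C := (fun x => (2 : ℝ) * x) '' C) (cA.insert a) (cB.insert b) (by simp) (by simp) (by
        intro x hx y hy
        refine ⟨midpoint ℝ x y, h x ?_ y ?_, ?_⟩
        · exact insert_subset ha hAA hx
        · exact insert_subset hb hBB hy
        · simp [midpoint_eq_smul_add])
    have h2 : volume ((fun x => (2 : ℝ) * x) '' C) = 2 * volume C := by
      have := Measure.addHaar_smul (volume : Measure ℝ) 2 C
      simpa [← image_smul] using this
    rw [h2] at this
    refine le_trans (add_le_add (measure_mono (subset_insert _ _))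
      (measure_mono (subset_insert _ _))) this
  rw [hA.measure_eq_iSup_isCompact, hB.measure_eq_iSup_isCompact]
  simp only [iSup_and']
  exact ENNReal.biSup_add_biSup_le' ⟨∅, by simp⟩ ⟨∅, by simp⟩
    fun A' h1 B' h2 => key A' h1.1 h1.2 B' h2.1 h2.2

theorem lintegral_add_le_two_mul_of_sup_eq_one {f g h : ℝ → ℝ} (hf : Measurable f)
    (hg : Measurable g) (hh : Measurable h) (f0 : ∀ x, 0 ≤ f x) (g0 : ∀ x, 0 ≤ g x)
    (h0 : ∀ x, 0 ≤ h x) (f1 : ∀ x, f x ≤ 1) (g1 : ∀ x, g x ≤ 1)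
    (f2 : ∀ t < 1, ∃ x, t < f x) (g2 : ∀ t < 1, ∃ x, t < g x)
    (hfg : ∀ x y, f x * g y ≤ h (midpoint ℝ x y) ^ 2) :
    (∫⁻ x, ENNReal.ofReal (f x)) + ∫⁻ x, ENNReal.ofReal (g x)
      ≤ 2 * ∫⁻ x, ENNReal.ofReal (h x) := by
  rw [lintegral_eq_lintegral_meas_lt _ (.of_forall f0) hf.aemeasurable,
    lintegral_eq_lintegral_meas_lt _ (.of_forall g0) hg.aemeasurable,
    lintegral_eq_lintegral_meas_lt _ (.of_forall h0) hh.aemeasurable,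
    ← lintegral_const_mul' _ _ (by simp), ← lintegral_add_left']
  · refine setLIntegral_mono' measurableSet_Ioi fun t ht => ?_
    by_cases ht1 : t < 1
    · refine volume_add_le_two_mul_of_midpoint_mem (hf measurableSet_Ioi)
        (hg measurableSet_Ioi) (f2 t ht1) (g2 t ht1) ?_
      intro a ha b hb
      simp only [mem_Ioi, mem_ofPred_eq] at *
      have : t * t < f a * g b := mul_lt_mul'' ha hb ht.le ht.le
      have := this.trans_le (hfg a b)
      nlinarith [h0 (midpoint ℝ a b)]
    · have e1 : {a | t < f a} = ∅ := by
        ext x; simp; linarith [f1 x]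
      have e2 : {a | t < g a} = ∅ := by
        ext x; simp; linarith [g1 x]
      simp [e1, e2]
  · refine Measurable.aemeasurable ?_
    exact Antitone.measurable fun s t hst => measure_mono fun x hx => hst.trans_lt hx

theorem four_mul_mul_le_add_sq (x y : ℝ≥0∞) : 4 * (x * y) ≤ (x + y) ^ 2 := by
  by_cases hx : x = ⊤
  · simp [hx]
  by_cases hy : y = ⊤
  · simp [hy]
  lift x to ℝ≥0 using hx
  lift y to ℝ≥0 using hy
  norm_cast
  have : (4 * (x * y) : ℝ) ≤ (x + y) ^ 2 := by nlinarith [sq_nonneg ((x : ℝ) - y)]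
  exact_mod_cast this

theorem mul_le_sq_of_add_le_two_mul {x y z : ℝ≥0∞} (h : x + y ≤ 2 * z) : x * y ≤ z ^ 2 := by
  have h1 : (4 : ℝ≥0∞) * (x * y) ≤ 4 * z ^ 2 := calc
    _ ≤ (x + y) ^ 2 := four_mul_mul_le_add_sq x y
    _ ≤ (2 * z) ^ 2 := by gcongr
    _ = 4 * z ^ 2 := by rw [mul_pow]; norm_num
  exact (ENNReal.mul_le_mul_iff_right (by norm_num) (by norm_num)).1 h1

theorem lintegral_mul_lintegral_le_sq_of_bounded {f g h : ℝ → ℝ} (hf : Measurable f)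
    (hg : Measurable g) (hh : Measurable h) (f0 : ∀ x, 0 ≤ f x) (g0 : ∀ x, 0 ≤ g x)
    (h0 : ∀ x, 0 ≤ h x) (M : ℝ) (f1 : ∀ x, f x ≤ M) (g1 : ∀ x, g x ≤ M)
    (hfg : ∀ x y, f x * g y ≤ h (midpoint ℝ x y) ^ 2) :
    (∫⁻ x, ENNReal.ofReal (f x)) * ∫⁻ x, ENNReal.ofReal (g x)
      ≤ (∫⁻ x, ENNReal.ofReal (h x)) ^ 2 := by
  have hbf : BddAbove (range f) := ⟨M, by rintro _ ⟨x, rfl⟩; exact f1 x⟩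
  have hbg : BddAbove (range g) := ⟨M, by rintro _ ⟨x, rfl⟩; exact g1 x⟩
  set a := ⨆ x, f x with ha
  set b := ⨆ x, g x with hb
  have fa : ∀ x, f x ≤ a := le_ciSup hbf
  have gb : ∀ x, g x ≤ b := le_ciSup hbg
  rcases ((f0 0).trans (fa 0)).eq_or_lt with ha0 | ha0
  · have : ∀ x, f x = 0 := fun x => le_antisymm (ha0 ▸ fa x) (f0 x)
    simp [this]
  rcases ((g0 0).trans (gb 0)).eq_or_lt with hb0 | hb0
  · have : ∀ x, g x = 0 := fun x => le_antisymm (hb0 ▸ gb x) (g0 x)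
    simp [this]
  have key := lintegral_add_le_two_mul_of_sup_eq_one (f := fun x => a⁻¹ * f x)
    (g := fun x => b⁻¹ * g x) (h := fun x => √(a⁻¹ * b⁻¹) * h x) (by fun_prop) (by fun_prop)
    (by fun_prop) (fun x => by have := f0 x; positivity) (fun x => by have := g0 x; positivity)
    (fun x => by have := h0 x; positivity)
    (fun x => by rw [inv_mul_le_iff₀ ha0]; simpa using fa x)
    (fun x => by rw [inv_mul_le_iff₀ hb0]; simpa using gb x)
    (fun t ht => by
      obtain ⟨x, hx⟩ := exists_lt_of_lt_ciSup (show a * t < ⨆ x, f x by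
        rw [← ha]; nlinarith)
      exact ⟨x, by rwa [lt_inv_mul_iff₀ ha0]⟩)
    (fun t ht => by
      obtain ⟨x, hx⟩ := exists_lt_of_lt_ciSup (show b * t < ⨆ x, g x by
        rw [← hb]; nlinarith)
      exact ⟨x, by rwa [lt_inv_mul_iff₀ hb0]⟩)
    (fun x y => by
      rw [mul_pow, Real.sq_sqrt (by positivity)]
      calc _ = a⁻¹ * b⁻¹ * (f x * g y) := by ring
        _ ≤ _ := by gcongr; exact hfg x y)
  have hs : √(a⁻¹ * b⁻¹) ^ 2 = a⁻¹ * b⁻¹ := Real.sq_sqrt (by positivity)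
  simp_rw [ENNReal.ofReal_mul (inv_nonneg.2 ha0.le), ENNReal.ofReal_mul (inv_nonneg.2 hb0.le),
    ENNReal.ofReal_mul (Real.sqrt_nonneg (a⁻¹ * b⁻¹))] at key
  rw [lintegral_const_mul' _ _ (by simp), lintegral_const_mul' _ _ (by simp),
    lintegral_const_mul' _ _ (by simp)] at key
  have key2 := mul_le_sq_of_add_le_two_mul key
  rw [mul_pow, ← ENNReal.ofReal_pow (by positivity), hs,
    ENNReal.ofReal_mul (inv_nonneg.2 ha0.le), mul_mul_mul_comm] at key2
  refine (ENNReal.mul_le_mul_iff_right ?_ ?_).1 key2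
  · simp [ha0, hb0]
  · exact ENNReal.mul_ne_top (by simp) (by simp)

/-- The midpoint Prékopa–Leindler property of a measure. -/
def PrekopaLeindler {X : Type*} [AddCommGroup X] [Module ℝ X] [MeasurableSpace X]
    (μ : Measure X) : Prop :=
  ∀ f g h : X → ℝ≥0∞, Measurable f → Measurable g → Measurable h →
    (∀ x y, f x * g y ≤ h (midpoint ℝ x y) ^ 2) →
    (∫⁻ x, f x ∂μ) * ∫⁻ x, g x ∂μ ≤ (∫⁻ x, h x ∂μ) ^ 2

theorem lintegral_eq_iSup_min {X : Type*} [MeasurableSpace X] {μ : Measure X} {f : X → ℝ≥0∞}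
    (hf : Measurable f) : ∫⁻ x, f x ∂μ = ⨆ N : ℕ, ∫⁻ x, min (f x) N ∂μ := by
  rw [← lintegral_iSup (fun N => hf.min measurable_const)
    (fun N M hNM x => min_le_min le_rfl (by exact_mod_cast hNM))]
  congr 1
  ext x
  rw [← inf_iSup_eq, ENNReal.iSup_natCast]
  simp

theorem prekopaLeindler_real : PrekopaLeindler (volume : Measure ℝ) := by
  intro f g h hf hg hh hfg
  have hm : ∀ N : ℕ, (∫⁻ x, min (f x) N) * ∫⁻ x, min (g x) N ≤ (∫⁻ x, h x) ^ 2 := by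
    intro N
    have e : ∀ (k : ℝ → ℝ≥0∞) x, ENNReal.ofReal (min (k x) N).toReal = min (k x) N := by
      intro k x
      exact ENNReal.ofReal_toReal (ne_top_of_le_ne_top (ENNReal.natCast_ne_top N)
        (min_le_right _ _))
    have b : ∀ (k : ℝ → ℝ≥0∞) x, (min (k x) N).toReal ≤ N := by
      intro k x
      have := ENNReal.toReal_mono (ENNReal.natCast_ne_top N) (min_le_right (k x) N)
      simpa using this
    have := lintegral_mul_lintegral_le_sq_of_bounded (f := fun x => (min (f x) N).toReal)
      (g := fun x => (min (g x) N).toReal) (h := fun x => (min (h x) N).toReal)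
      (by fun_prop) (by fun_prop) (by fun_prop) (by simp) (by simp) (by simp) N
      (b f) (b g) (by
        intro x y
        rw [← ENNReal.toReal_mul, ← ENNReal.toReal_pow]
        refine ENNReal.toReal_mono (ENNReal.pow_ne_top (ne_top_of_le_ne_top
          (ENNReal.natCast_ne_top N) (min_le_right _ _))) ?_
        rcases le_total (h (midpoint ℝ x y)) N with hN | hN
        · rw [min_eq_left hN]
          exact (mul_le_mul' (min_le_left _ _) (min_le_left _ _)).trans (hfg x y)
        · rw [min_eq_right hN, sq]
          exact mul_le_mul' (min_le_right _ _) (min_le_right _ _))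
    simp_rw [e] at this
    refine this.trans ?_
    gcongr
    exact min_le_left _ _
  rw [lintegral_eq_iSup_min hf, lintegral_eq_iSup_min hg]
  have mono : ∀ k : ℝ → ℝ≥0∞, Monotone fun N : ℕ => ∫⁻ x, min (k x) N := fun k N M hNM =>
    lintegral_mono fun x => min_le_min le_rfl (by exact_mod_cast hNM)
  rw [ENNReal.iSup_mul]
  refine iSup_le fun N => ?_
  rw [ENNReal.mul_iSup]
  refine iSup_le fun M => ?_
  exact (mul_le_mul' (mono f (le_max_left N M)) (mono g (le_max_right N M))).trans (hm _)

theorem PrekopaLeindler.prod {X Y : Type*} [AddCommGroup X] [Module ℝ X] [MeasurableSpace X]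
    [AddCommGroup Y] [Module ℝ Y] [MeasurableSpace Y] {μ : Measure X} {ν : Measure Y}
    [SFinite ν] (hμ : PrekopaLeindler μ) (hν : PrekopaLeindler ν) :
    PrekopaLeindler (μ.prod ν) := by
  intro f g h hf hg hh hfg
  rw [lintegral_prod _ hf.aemeasurable, lintegral_prod _ hg.aemeasurable,
    lintegral_prod _ hh.aemeasurable]
  refine hμ _ _ _ hf.lintegral_prod_right' hg.lintegral_prod_right' hh.lintegral_prod_right' ?_
  intro x x'
  exact hν _ _ _ (by fun_prop) (by fun_prop) (by fun_prop) fun y y' => hfg (x, y) (x', y')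

theorem PrekopaLeindler.map {X Y : Type*} [AddCommGroup X] [Module ℝ X] [MeasurableSpace X]
    [AddCommGroup Y] [Module ℝ Y] [MeasurableSpace Y] {μ : Measure X} {ν : Measure Y}
    (hμ : PrekopaLeindler μ) (e : X →ₗ[ℝ] Y) (he : MeasurePreserving e μ ν) :
    PrekopaLeindler ν := by
  intro f g h hf hg hh hfg
  rw [← he.lintegral_comp hf, ← he.lintegral_comp hg, ← he.lintegral_comp hh]
  refine hμ _ _ _ (hf.comp he.measurable) (hg.comp he.measurable) (hh.comp he.measurable) ?_
  intro x y
  refine (hfg (e x) (e y)).trans_eq ?_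
  rw [show midpoint ℝ (e x) (e y) = e (midpoint ℝ x y) by simp [midpoint_eq_smul_add]]

theorem prekopaLeindler_pi (n : ℕ) : PrekopaLeindler (volume : Measure (Fin n → ℝ)) := by
  induction n with
  | zero =>
    intro f g h _ _ _ hfg
    rw [volume_pi, Measure.pi_of_empty _ 0]
    simpa using (hfg 0 0).trans_eq (by congr 2; exact Subsingleton.elim _ _)
  | succ n ih =>
    refine (prekopaLeindler_real.prod ih).map
      (Fin.consLinearEquiv ℝ (fun _ => ℝ)).toLinearMap ?_
    have e : ⇑(Fin.consLinearEquiv ℝ fun _ : Fin (n + 1) => ℝ).toLinearMap =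
        (MeasurableEquiv.piFinSuccAbove (fun _ : Fin (n + 1) => ℝ) 0).symm := by
      ext x i
      simp [MeasurableEquiv.piFinSuccAbove]
    rw [e]
    exact (volume_preserving_piFinSuccAbove (fun _ : Fin (n + 1) => ℝ) 0).symm

theorem prekopaLeindler_euclideanSpace (n : ℕ) : PrekopaLeindler (volume : Measure (E n)) :=
  (prekopaLeindler_pi n).map (WithLp.linearEquiv 2 ℝ (Fin n → ℝ)).symm.toLinearMap
    (PiLp.volume_preserving_toLp _)

/-! ### Symmetric log-concave random variables -/

/-- The law of `f` under `μ` is symmetric and its tail function is midpoint log-concave. -/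
structure IsSymmLogConcave {X : Type*} [MeasurableSpace X] (μ : Measure X) (f : X → ℝ) :
    Prop where
  measurable : Measurable f
  symm : ∀ t, μ {x | f x ≤ -t} = μ {x | t ≤ f x}
  logConcave : ∀ a b, μ {x | a ≤ f x} * μ {x | b ≤ f x} ≤ μ {x | midpoint ℝ a b ≤ f x} ^ 2

namespace IsSymmLogConcave

variable {X : Type*} [MeasurableSpace X] {μ : Measure X} [IsFiniteMeasure μ] {f : X → ℝ}

theorem measureReal_le_abs (h : IsSymmLogConcave μ f) {t : ℝ} (ht : 0 < t) :
    μ.real {x | t ≤ |f x|} = 2 * μ.real {x | t ≤ f x} := by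
  have e : {x | t ≤ |f x|} = {x | t ≤ f x} ∪ {x | f x ≤ -t} := by
    ext x
    simp only [le_abs, mem_ofPred_eq, mem_union]
    exact or_congr Iff.rfl le_neg
  have hs : μ.real {x | f x ≤ -t} = μ.real {x | t ≤ f x} := by
    simp only [Measure.real, h.symm t]
  rw [e, measureReal_union, hs]
  · ring
  · rw [disjoint_left]
    intro x (hx : t ≤ f x) (hx' : f x ≤ -t)
    linarith
  · exact h.measurable measurableSet_Iic

theorem univ_le_two_mul (h : IsSymmLogConcave μ f) :
    μ.real univ ≤ 2 * μ.real {x | 0 ≤ f x} := by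
  have hs : μ.real {x | f x ≤ 0} = μ.real {x | 0 ≤ f x} := by
    simpa [Measure.real] using congrArg ENNReal.toReal (h.symm 0)
  have : (univ : Set X) ⊆ {x | 0 ≤ f x} ∪ {x | f x ≤ 0} := fun x _ => le_total 0 (f x)
  calc _ ≤ _ := measureReal_mono this
    _ ≤ _ := measureReal_union_le _ _
    _ = _ := by rw [hs]; ring

theorem univ_mul_tail_le (h : IsSymmLogConcave μ f) (t : ℝ) :
    μ.real univ * μ.real {x | 2 * t ≤ f x} ≤ 2 * μ.real {x | t ≤ f x} ^ 2 := by
  have h1 : μ.real {x | 0 ≤ f x} * μ.real {x | 2 * t ≤ f x} ≤ μ.real {x | t ≤ f x} ^ 2 := by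
    have := ENNReal.toReal_mono (by simp) (h.logConcave 0 (2 * t))
    rw [show midpoint ℝ 0 (2 * t) = t by simp [midpoint_eq_smul_add]] at this
    simpa [Measure.real] using this
  have h2 := h.univ_le_two_mul
  have h3 : 0 ≤ μ.real {x | 2 * t ≤ f x} := measureReal_nonneg
  nlinarith

theorem tail_pow_le (h : IsSymmLogConcave μ f) (hμ : 0 < μ.real univ) (s : ℝ) (j : ℕ) :
    2 * μ.real {x | 2 ^ j * s ≤ f x} / μ.real univ
      ≤ (2 * μ.real {x | s ≤ f x} / μ.real univ) ^ (2 ^ j) := by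
  induction j with
  | zero => simp
  | succ j ih =>
    rw [pow_succ (2 : ℕ) j, pow_mul]
    refine le_trans ?_ (pow_le_pow_left₀ (by positivity) ih 2)
    have := h.univ_mul_tail_le (2 ^ j * s)
    rw [show (2 : ℝ) ^ (j + 1) * s = 2 * (2 ^ j * s) by ring, div_pow, div_le_div_iff₀ hμ
      (by positivity)]
    nlinarith

theorem tail_le_exp (h : IsSymmLogConcave μ f) (hμ : 0 < μ.real univ) {s t : ℝ} (hs : 0 < s)
    (ht : 0 < t) :
    μ.real {x | t ≤ |f x|}
      ≤ 4 * μ.real univ * Real.exp (-(μ.real {x | |f x| < s} / μ.real univ / (2 * s)) * t) := by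
  set m := μ.real univ with hm
  set d := μ.real {x | |f x| < s} / m with hd
  have hd1 : d ≤ 1 := (div_le_one hμ).2 (measureReal_mono (subset_univ _))
  have hd0 : 0 ≤ d := by positivity
  have hds : 2 * μ.real {x | s ≤ f x} / m = 1 - d := by
    rw [← h.measureReal_le_abs hs, hd, eq_sub_iff_add_eq, ← add_div, div_eq_one_iff_eq hμ.ne', hm]
    have : {x | |f x| < s} = {x | s ≤ |f x|}ᶜ := by ext; simp
    rw [this]
    exact measureReal_add_measureReal_compl (measurableSet_le measurable_const h.measurable.abs)
  rcases lt_or_ge t s with hts | hts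
  · have h1 : μ.real {x | t ≤ |f x|} ≤ m := measureReal_mono (subset_univ _)
    have h2 : (1 : ℝ) / 2 ≤ Real.exp (-(d / (2 * s)) * t) := by
      refine le_trans ?_ (Real.add_one_le_exp _)
      have : d / (2 * s) * t ≤ 1 / 2 := by
        rw [div_mul_eq_mul_div, div_le_div_iff₀ (by positivity) (by positivity)]
        nlinarith
      linarith
    nlinarith
  · obtain ⟨j, hj1, hj2⟩ := exists_nat_pow_near (x := t / s) (y := 2)
      ((one_le_div hs).2 hts) (by norm_num)
    rw [le_div_iff₀ hs] at hj1
    rw [div_lt_iff₀ hs] at hj2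
    have h1 : 2 * μ.real {x | t ≤ f x} / m ≤ (1 - d) ^ (2 ^ j) := by
      rw [← hds]
      refine le_trans ?_ (h.tail_pow_le hμ s j)
      have : μ.real {x | t ≤ f x} ≤ μ.real {x | 2 ^ j * s ≤ f x} :=
        measureReal_mono fun x (hx : t ≤ f x) => hj1.trans hx
      gcongr
    have h2 : (1 - d) ^ (2 ^ j) ≤ Real.exp (-(d / (2 * s)) * t) := by
      calc (1 - d) ^ (2 ^ j) ≤ Real.exp (-d) ^ (2 ^ j) := by
            exact pow_le_pow_left₀ (by linarith) (Real.one_sub_le_exp_neg d) _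
        _ = Real.exp (-d * 2 ^ j) := by rw [← Real.exp_nat_mul]; congr 1; push_cast; ring
        _ ≤ _ := by
          apply Real.exp_le_exp.2
          have : d / (2 * s) * t ≤ d * 2 ^ j := by
            rw [div_mul_eq_mul_div, div_le_iff₀ (by positivity)]
            calc d * t ≤ d * (2 ^ (j + 1) * s) := by gcongr
              _ = _ := by ring
          linarith
    rw [h.measureReal_le_abs ht]
    have h3 := (div_le_iff₀ hμ).1 (h1.trans h2)
    have : 0 ≤ Real.exp (-(d / (2 * s)) * t) * m := by positivity
    linarith

theorem lintegral_sq_le (h : IsSymmLogConcave μ f) (hμ : 0 < μ.real univ) {s : ℝ} (hs : 0 < s)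
    (hpos : 0 < μ.real {x | |f x| < s}) :
    ∫⁻ x, ENNReal.ofReal (f x ^ 2) ∂μ
      ≤ ENNReal.ofReal (32 * μ.real univ * (s / (μ.real {x | |f x| < s} / μ.real univ)) ^ 2) := by
  set m := μ.real univ with hm
  set d := μ.real {x | |f x| < s} / m with hd
  have hd0 : 0 < d := by positivity
  have key := lintegral_rpow_eq_lintegral_meas_le_mul μ (f := fun x => |f x|)
    (.of_forall fun x => abs_nonneg _) h.measurable.abs.aemeasurable (p := 2) (by norm_num)
  simp only [Real.rpow_two, sq_abs] at key
  rw [key]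
  have hG := Real.integral_rpow_mul_exp_neg_mul_Ioi (a := 2) (r := d / (2 * s)) (by norm_num)
    (by positivity)
  have hI : IntegrableOn (fun t : ℝ => t ^ ((2 : ℝ) - 1) * Real.exp (-(d / (2 * s) * t)))
      (Ioi 0) := by
    by_contra hcon
    rw [integral_undef hcon, eq_comm] at hG
    have := Real.Gamma_pos_of_pos (s := 2) (by norm_num)
    refine absurd hG (ne_of_gt ?_)
    positivity
  calc _ ≤ ENNReal.ofReal 2 * ∫⁻ t in Ioi (0 : ℝ), ENNReal.ofReal (4 * m *
        (t ^ ((2 : ℝ) - 1) * Real.exp (-(d / (2 * s) * t)))) := by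
        gcongr ENNReal.ofReal 2 * ?_
        refine setLIntegral_mono' measurableSet_Ioi fun t (ht : 0 < t) => ?_
        have := h.tail_le_exp hμ hs ht
        rw [← ofReal_measureReal, ← ENNReal.ofReal_mul measureReal_nonneg]
        refine ENNReal.ofReal_le_ofReal ?_
        calc _ ≤ _ := mul_le_mul_of_nonneg_right this (by positivity)
          _ = _ := by rw [neg_mul]; ring
    _ = _ := by
        rw [← ofReal_integral_eq_lintegral_ofReal (hI.const_mul _), integral_const_mul, hG,
          ← ENNReal.ofReal_mul (by norm_num)]
        · congr 1
          simp
          field_simp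
          ring
        · filter_upwards [ae_restrict_mem measurableSet_Ioi] with t ht
          have : (0 : ℝ) < t := ht
          positivity

/-- Small ball estimate: `P(|f| < s) ≤ 6 s / τ`, where `τ²` is at most the second moment. -/
theorem smallBall (h : IsSymmLogConcave μ f) (hμ : 0 < μ.real univ) {τ : ℝ} (hτ : 0 < τ)
    (hm : ENNReal.ofReal (τ ^ 2) * μ univ ≤ ∫⁻ x, ENNReal.ofReal (f x ^ 2) ∂μ)
    {s : ℝ} (hs : 0 < s) :
    μ.real {x | |f x| < s} ≤ 6 * μ.real univ / τ * s := by
  rcases (measureReal_nonneg (μ := μ) (s := {x | |f x| < s})).eq_or_lt with h0 | h0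
  · rw [← h0]; positivity
  have := hm.trans (h.lintegral_sq_le hμ hs h0)
  rw [← ofReal_measureReal (μ := μ) (s := univ), ← ENNReal.ofReal_mul (by positivity),
    ENNReal.ofReal_le_ofReal_iff (by positivity)] at this
  set m := μ.real univ with hm
  set d := μ.real {x | |f x| < s} with hd
  have h1 : τ ^ 2 ≤ 32 * (s / (d / m)) ^ 2 := by nlinarith
  have h2 : τ ^ 2 ≤ (6 * (s / (d / m))) ^ 2 := h1.trans (by
    rw [mul_pow]; gcongr; norm_num)
  have h3 := (pow_le_pow_iff_left₀ hτ.le (by positivity) two_ne_zero).1 h2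
  rw [div_div_eq_mul_div, ← mul_div_assoc, le_div_iff₀ h0] at h3
  rw [div_mul_eq_mul_div, le_div_iff₀ hτ]
  linarith

/-- Reverse Hölder inequality for the negative moment of order `1/2`. -/
theorem lintegral_rpow_neg_half_le (h : IsSymmLogConcave μ f) (hμ : 0 < μ.real univ) {τ : ℝ}
    (hτ : 0 < τ) (hm : ENNReal.ofReal (τ ^ 2) * μ univ ≤ ∫⁻ x, ENNReal.ofReal (f x ^ 2) ∂μ) :
    ∫⁻ x, ENNReal.ofReal (|f x| ^ (-(1 / 2) : ℝ)) ∂μ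
      ≤ ENNReal.ofReal (7 * τ ^ (-(1 / 2) : ℝ)) * μ univ := by
  rw [lintegral_eq_lintegral_meas_lt μ (.of_forall fun x => by positivity)
    (h.measurable.abs.pow_const _).aemeasurable]
  set Y := τ ^ (-(1 / 2) : ℝ) with hY
  have hY0 : 0 < Y := by positivity
  have hYτ : Y ^ 2 = τ⁻¹ := by
    rw [hY, ← Real.rpow_natCast, ← Real.rpow_mul hτ.le, ← Real.rpow_neg_one]; norm_num
  have hunion : Ioi (0 : ℝ) = Ioc 0 Y ∪ Ioi Y := (Ioc_union_Ioi_eq_Ioi hY0.le).symm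
  have hI : IntegrableOn (fun t : ℝ => t ^ (-2 : ℝ)) (Ioi Y) :=
    integrableOn_Ioi_rpow_of_lt (by norm_num) hY0
  have hG := integral_Ioi_rpow_of_lt (a := -2) (by norm_num) hY0
  rw [hunion]
  refine (lintegral_union_le _ _ _).trans ?_
  have b1 : ∫⁻ t in Ioc 0 Y, μ {x | t < |f x| ^ (-(1 / 2) : ℝ)} ≤ ENNReal.ofReal Y * μ univ := by
    calc _ ≤ ∫⁻ t in Ioc 0 Y, μ univ := lintegral_mono fun t => measure_mono (subset_univ _)
      _ = _ := by simp [mul_comm]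
  have b2 : ∫⁻ t in Ioi Y, μ {x | t < |f x| ^ (-(1 / 2) : ℝ)} ≤ ENNReal.ofReal (6 * Y) * μ univ := by
    calc _ ≤ ∫⁻ t in Ioi Y, ENNReal.ofReal (6 * μ.real univ / τ * t ^ (-2 : ℝ)) := by
          refine setLIntegral_mono' measurableSet_Ioi fun t (ht : Y < t) => ?_
          have ht0 : 0 < t := hY0.trans ht
          rw [← ofReal_measureReal]
          refine ENNReal.ofReal_le_ofReal (le_trans ?_ (h.smallBall hμ hτ hm (by positivity)))
          refine measureReal_mono fun x (hx : t < _) => ?_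
          have hfx : 0 < |f x| := by
            rw [abs_pos]
            rintro h0
            rw [h0, abs_zero, Real.zero_rpow (by norm_num)] at hx
            linarith
          have := Real.rpow_lt_rpow_of_neg ht0 hx (z := -2) (by norm_num)
          rw [← Real.rpow_mul hfx.le] at this
          norm_num at this
          simpa using this
      _ = _ := by
          rw [← ofReal_integral_eq_lintegral_ofReal (hI.const_mul _), integral_const_mul, hG,
            ← ofReal_measureReal (μ := μ) (s := univ), ← ENNReal.ofReal_mul (by positivity)]
          · congr 1
            have : Y ^ (-2 + 1 : ℝ) = Y * τ := by
              norm_num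
              rw [Real.rpow_neg_one]
              field_simp
              rw [hYτ]; field_simp
            rw [this]
            field_simp
            norm_num
          · filter_upwards [ae_restrict_mem measurableSet_Ioi] with t ht
            have : (0 : ℝ) < t := hY0.trans ht
            positivity
  refine (add_le_add b1 b2).trans_eq ?_
  rw [← add_mul, ← ENNReal.ofReal_add hY0.le (by positivity)]
  congr 2; ring

theorem ae_ne_zero (h : IsSymmLogConcave μ f) (hμ : 0 < μ.real univ) {τ : ℝ} (hτ : 0 < τ)
    (hm : ENNReal.ofReal (τ ^ 2) * μ univ ≤ ∫⁻ x, ENNReal.ofReal (f x ^ 2) ∂μ) :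
    ∀ᵐ x ∂μ, f x ≠ 0 := by
  rw [ae_iff]
  simp only [not_not]
  rw [← measureReal_eq_zero_iff]
  refine le_antisymm (le_of_forall_pos_le_add fun ε hε => ?_) measureReal_nonneg
  have := h.smallBall hμ hτ hm (s := ε * τ / (6 * μ.real univ)) (by positivity)
  calc μ.real {x | f x = 0} ≤ _ := measureReal_mono (fun x (hx : f x = 0) => by
        simp [hx]; positivity)
    _ ≤ _ := this
    _ = _ := by field_simp; simp

end IsSymmLogConcave

theorem rpow_half_mul_rpow_neg_half {τ : ℝ} (hτ : 0 < τ) :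
    (τ / 49) ^ (1 / 2 : ℝ) * (7 * τ ^ (-(1 / 2) : ℝ)) = 1 := by
  obtain ⟨b, rfl⟩ : ∃ b, τ = b * 7 ^ 2 := ⟨τ / 49, by ring⟩
  have hb0 : 0 < b := by linarith
  rw [show b * 7 ^ 2 / 49 = b by ring, Real.mul_rpow hb0.le (by norm_num), ← Real.rpow_natCast,
    ← Real.rpow_mul (by norm_num), Real.rpow_neg hb0.le]
  norm_num
  field_simp

theorem one_add_mul_le_rpow {w p : ℝ} (hw : 0 < w) (hp : 0 < p) :
    1 + 2 * p * (1 - w ^ (-(1 / 2) : ℝ)) ≤ w ^ p := by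
  have h1 := Real.add_one_le_exp (p * Real.log w)
  rw [mul_comm p, ← Real.rpow_def_of_pos hw] at h1
  have h2 := Real.log_le_sub_one_of_pos (x := w ^ (-(1 / 2) : ℝ)) (by positivity)
  rw [Real.log_rpow hw] at h2
  nlinarith

theorem two_mul_le_log {w : ℝ} (hw : 0 < w) :
    2 * (1 - w ^ (-(1 / 2) : ℝ)) ≤ Real.log w := by
  have h2 := Real.log_le_sub_one_of_pos (x := w ^ (-(1 / 2) : ℝ)) (by positivity)
  rw [Real.log_rpow hw] at h2
  linarith

theorem abs_log_le {u : ℝ} (hu : 0 ≤ u) :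
    |Real.log u| ≤ u + 2 * u ^ (-(1 / 2) : ℝ) := by
  rcases hu.eq_or_lt with rfl | hu
  · simp
  have h1 := two_mul_le_log hu
  have h2 := Real.log_le_sub_one_of_pos hu
  have h3 : 0 < u ^ (-(1 / 2) : ℝ) := by positivity
  rw [abs_le]
  constructor <;> linarith

namespace IsSymmLogConcave

variable {X : Type*} [MeasurableSpace X] {μ : Measure X} [IsFiniteMeasure μ] {f : X → ℝ}

/-- Reverse Hölder inequality for positive moments, with a constant independent of the order. -/
theorem le_lintegral_rpow (h : IsSymmLogConcave μ f) (hμ : 0 < μ.real univ) {τ : ℝ} (hτ : 0 < τ)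
    (hm : ENNReal.ofReal (τ ^ 2) * μ univ ≤ ∫⁻ x, ENNReal.ofReal (f x ^ 2) ∂μ)
    {p : ℝ} (hp : 0 < p) :
    ENNReal.ofReal ((τ / 49) ^ p) * μ univ ≤ ∫⁻ x, ENNReal.ofReal (|f x| ^ p) ∂μ := by
  set b := τ / 49 with hb
  have hb0 : 0 < b := by positivity
  have e1 : b ^ (1 / 2 : ℝ) * (7 * τ ^ (-(1 / 2) : ℝ)) = 1 := rpow_half_mul_rpow_neg_half hτ
  have pw : ∀ᵐ x ∂μ, ENNReal.ofReal (b ^ p * (1 + 2 * p)) ≤ ENNReal.ofReal (|f x| ^ p)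
      + ENNReal.ofReal (2 * p * b ^ p * b ^ (1 / 2 : ℝ)) *
        ENNReal.ofReal (|f x| ^ (-(1 / 2) : ℝ)) := by
    filter_upwards [h.ae_ne_zero hμ hτ hm] with x hx
    have hx' : 0 < |f x| := abs_pos.2 hx
    rw [← ENNReal.ofReal_mul (by positivity), ← ENNReal.ofReal_add (by positivity) (by positivity)]
    refine ENNReal.ofReal_le_ofReal ?_
    have := one_add_mul_le_rpow (w := |f x| / b) (by positivity) hp
    rw [Real.div_rpow hx'.le hb0.le, Real.div_rpow hx'.le hb0.le, Real.rpow_neg hb0.le,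
      div_inv_eq_mul, le_div_iff₀ (by positivity)] at this
    linarith
  have := lintegral_mono_ae pw
  rw [lintegral_add_left (by have := h.measurable; fun_prop), lintegral_const_mul' _ _ (by simp),
    lintegral_const] at this
  have h2 := this.trans (add_le_add_right (mul_le_mul_right
    (h.lintegral_rpow_neg_half_le hμ hτ hm) _) _)
  rw [← mul_assoc, ← ENNReal.ofReal_mul (by positivity), mul_assoc (2 * p * b ^ p), e1, mul_one,
    mul_add, mul_one, ENNReal.ofReal_add (by positivity) (by positivity), add_mul,
    show b ^ p * (2 * p) = 2 * p * b ^ p by ring] at h2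
  exact (ENNReal.add_le_add_iff_right (ENNReal.mul_ne_top (by simp) (by simp))).1 h2

theorem integrable_rpow_neg_half (h : IsSymmLogConcave μ f) (hμ : 0 < μ.real univ) {τ : ℝ}
    (hτ : 0 < τ) (hm : ENNReal.ofReal (τ ^ 2) * μ univ ≤ ∫⁻ x, ENNReal.ofReal (f x ^ 2) ∂μ) :
    Integrable (fun x => |f x| ^ (-(1 / 2) : ℝ)) μ := by
  refine (lintegral_ofReal_ne_top_iff_integrable
    (h.measurable.abs.pow_const _).aestronglyMeasurable (.of_forall fun x => by positivity)).1 ?_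
  exact ne_top_of_le_ne_top (ENNReal.mul_ne_top ENNReal.ofReal_ne_top (by simp))
    (h.lintegral_rpow_neg_half_le hμ hτ hm)

theorem integral_rpow_neg_half_le (h : IsSymmLogConcave μ f) (hμ : 0 < μ.real univ) {τ : ℝ}
    (hτ : 0 < τ) (hm : ENNReal.ofReal (τ ^ 2) * μ univ ≤ ∫⁻ x, ENNReal.ofReal (f x ^ 2) ∂μ) :
    ∫ x, |f x| ^ (-(1 / 2) : ℝ) ∂μ ≤ 7 * τ ^ (-(1 / 2) : ℝ) * μ.real univ := by
  have := h.lintegral_rpow_neg_half_le hμ hτ hm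
  rw [← ofReal_integral_eq_lintegral_ofReal (h.integrable_rpow_neg_half hμ hτ hm)
    (.of_forall fun x => by positivity), ← ofReal_measureReal (μ := μ) (s := univ),
    ← ENNReal.ofReal_mul (by positivity)] at this
  exact (ENNReal.ofReal_le_ofReal_iff (by positivity)).1 this

theorem integrable_log (h : IsSymmLogConcave μ f) (hμ : 0 < μ.real univ) {τ : ℝ} (hτ : 0 < τ)
    (hm : ENNReal.ofReal (τ ^ 2) * μ univ ≤ ∫⁻ x, ENNReal.ofReal (f x ^ 2) ∂μ)
    (hf : Integrable f μ) :
    Integrable (fun x => Real.log |f x|) μ := by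
  refine Integrable.mono' (hf.abs.add ((h.integrable_rpow_neg_half hμ hτ hm).const_mul 2))
    (Real.measurable_log.comp h.measurable.abs).aestronglyMeasurable (.of_forall fun x => ?_)
  exact abs_log_le (abs_nonneg _)

theorem integral_abs_log_le (h : IsSymmLogConcave μ f) (hμ : 0 < μ.real univ) {τ : ℝ} (hτ : 0 < τ)
    (hm : ENNReal.ofReal (τ ^ 2) * μ univ ≤ ∫⁻ x, ENNReal.ofReal (f x ^ 2) ∂μ)
    (hf : Integrable f μ) :
    ∫ x, |(Real.log |f x|)| ∂μ ≤ (∫ x, |f x| ∂μ) + 14 * τ ^ (-(1 / 2) : ℝ) * μ.real univ := by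
  have hI := h.integrable_rpow_neg_half hμ hτ hm
  calc _ ≤ ∫ x, (|f x| + 2 * |f x| ^ (-(1 / 2) : ℝ)) ∂μ :=
        integral_mono (h.integrable_log hμ hτ hm hf).abs (hf.abs.add (hI.const_mul 2))
          fun x => abs_log_le (abs_nonneg _)
    _ = _ := integral_add hf.abs (hI.const_mul 2)
    _ ≤ _ := by
      rw [integral_const_mul]
      linarith [h.integral_rpow_neg_half_le hμ hτ hm]

/-- Reverse Hölder inequality for the geometric mean. -/
theorem le_integral_log (h : IsSymmLogConcave μ f) (hμ : 0 < μ.real univ) {τ : ℝ} (hτ : 0 < τ)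
    (hm : ENNReal.ofReal (τ ^ 2) * μ univ ≤ ∫⁻ x, ENNReal.ofReal (f x ^ 2) ∂μ)
    (hf : Integrable f μ) :
    μ.real univ * Real.log (τ / 49) ≤ ∫ x, Real.log |f x| ∂μ := by
  set b := τ / 49 with hb
  have hb0 : 0 < b := by positivity
  have e1 : b ^ (1 / 2 : ℝ) * (7 * τ ^ (-(1 / 2) : ℝ)) = 1 := rpow_half_mul_rpow_neg_half hτ
  have hI := h.integrable_rpow_neg_half hμ hτ hm
  have hJ : Integrable (fun x => 2 * b ^ (1 / 2 : ℝ) * |f x| ^ (-(1 / 2) : ℝ)) μ := hI.const_mul _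
  have pw : ∀ᵐ x ∂μ, (Real.log b + 2) - 2 * b ^ (1 / 2 : ℝ) * |f x| ^ (-(1 / 2) : ℝ)
      ≤ Real.log |f x| := by
    filter_upwards [h.ae_ne_zero hμ hτ hm] with x hx
    have hx' : 0 < |f x| := abs_pos.2 hx
    have := two_mul_le_log (w := |f x| / b) (by positivity)
    rw [Real.div_rpow hx'.le hb0.le, Real.rpow_neg hb0.le, div_inv_eq_mul,
      Real.log_div hx'.ne' hb0.ne'] at this
    linarith
  have := integral_mono_ae ((integrable_const _).sub hJ) (h.integrable_log hμ hτ hm hf) pw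
  refine le_trans ?_ this
  have h1 : ∫ x, (Real.log b + 2) - 2 * b ^ (1 / 2 : ℝ) * |f x| ^ (-(1 / 2) : ℝ) ∂μ
      = μ.real univ * (Real.log b + 2) - 2 * b ^ (1 / 2 : ℝ) * ∫ x, |f x| ^ (-(1 / 2) : ℝ) ∂μ := by
    rw [integral_sub (integrable_const _) hJ, integral_const_mul]
    simp
  have h2 := mul_le_mul_of_nonneg_left (h.integral_rpow_neg_half_le hμ hτ hm)
    (show 0 ≤ 2 * b ^ (1 / 2 : ℝ) by positivity)
  have h3 : 2 * b ^ (1 / 2 : ℝ) * (7 * τ ^ (-(1 / 2) : ℝ) * μ.real univ) = 2 * μ.real univ := by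
    calc _ = 2 * (b ^ (1 / 2 : ℝ) * (7 * τ ^ (-(1 / 2) : ℝ))) * μ.real univ := by ring
      _ = _ := by rw [e1]; ring
  change _ ≤ ∫ x, (Real.log b + 2) - 2 * b ^ (1 / 2 : ℝ) * |f x| ^ (-(1 / 2) : ℝ) ∂μ
  rw [h1]
  linarith

end IsSymmLogConcave

/-- Linear functionals on a centrally symmetric convex body are symmetric and log-concave. -/
theorem isSymmLogConcave_inner {n : ℕ} {K : Set (E n)} (hK : MeasurableSet K) (hc : Convex ℝ K)
    (hs : ∀ x ∈ K, -x ∈ K) (v : E n) :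
    IsSymmLogConcave (volume.restrict K) (fun x => ⟪x, v⟫) where
  measurable := by fun_prop
  symm t := by
    rw [Measure.restrict_apply (measurableSet_le (by fun_prop) (by fun_prop)),
      Measure.restrict_apply (measurableSet_le (by fun_prop) (by fun_prop)),
      ← Measure.measure_neg]
    congr 1
    ext x
    simp only [mem_inter_iff, mem_ofPred_eq, Set.mem_neg, inner_neg_left, neg_le_neg_iff]
    exact and_congr Iff.rfl ⟨fun h => by simpa using hs _ h, hs x⟩
  logConcave a b := by
    have hm : ∀ t : ℝ, MeasurableSet {x : E n | t ≤ ⟪x, v⟫} := fun t =>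
      measurableSet_le (by fun_prop) (by fun_prop)
    rw [Measure.restrict_apply (hm _), Measure.restrict_apply (hm _),
      Measure.restrict_apply (hm _)]
    have := prekopaLeindler_euclideanSpace n (({x | a ≤ ⟪x, v⟫} ∩ K).indicator 1)
      (({x | b ≤ ⟪x, v⟫} ∩ K).indicator 1) (({x | midpoint ℝ a b ≤ ⟪x, v⟫} ∩ K).indicator 1)
      (measurable_one.indicator ((hm _).inter hK)) (measurable_one.indicator ((hm _).inter hK))
      (measurable_one.indicator ((hm _).inter hK)) ?_
    · rwa [lintegral_indicator_one ((hm _).inter hK), lintegral_indicator_one ((hm _).inter hK),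
        lintegral_indicator_one ((hm _).inter hK)] at this
    · intro x y
      by_cases hx : x ∈ {x | a ≤ ⟪x, v⟫} ∩ K
      swap
      · rw [indicator_of_notMem hx]; simp
      by_cases hy : y ∈ {x | b ≤ ⟪x, v⟫} ∩ K
      swap
      · rw [indicator_of_notMem hy]; simp
      have hxy : midpoint ℝ x y ∈ {x | midpoint ℝ a b ≤ ⟪x, v⟫} ∩ K := by
        refine ⟨?_, hc.midpoint_mem hx.2 hy.2⟩
        have h1 : a ≤ _ := hx.1
        have h2 : b ≤ _ := hy.1
        simp only [midpoint_eq_smul_add, smul_eq_mul, mem_ofPred_eq, inner_add_left,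
          inner_smul_left, invOf_eq_inv]
        simp
        linarith
      rw [indicator_of_mem hx, indicator_of_mem hy, indicator_of_mem hxy]
      simp

/-! ### Moments of linear functionals on the sphere -/

theorem lintegral_volumeIoiPow (k : ℕ) {G : ℝ → ℝ≥0∞} (hG : Measurable G) :
    ∫⁻ r, G r ∂(Measure.volumeIoiPow k) = ∫⁻ r in Ioi (0 : ℝ), ENNReal.ofReal (r ^ k) * G r := by
  rw [Measure.volumeIoiPow, lintegral_withDensity_eq_lintegral_mul _ (by fun_prop) (by fun_prop)]
  exact lintegral_subtype_comap measurableSet_Ioi (fun r : ℝ => ENNReal.ofReal (r ^ k) * G r)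

/-- Integration in polar coordinates of a homogeneous function times a radial function. -/
theorem lintegral_homogeneous_mul_radial {n : ℕ} (hn : 1 ≤ n) {Φ : E n → ℝ≥0∞} (hΦ : Measurable Φ)
    {G : ℝ → ℝ≥0∞} (hG : Measurable G) (q : ℝ)
    (hq : ∀ r : ℝ, 0 < r → ∀ x, Φ (r • x) = ENNReal.ofReal (r ^ q) * Φ x) :
    ∫⁻ x, Φ x * G ‖x‖ = (∫⁻ θ : Metric.sphere (0 : E n) 1, Φ θ ∂(volume : Measure (E n)).toSphere) *
      ∫⁻ r in Ioi (0 : ℝ), ENNReal.ofReal (r ^ (n - 1) * r ^ q) * G r := by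
  have : Nontrivial (E n) := by
    have : Nonempty (Fin n) := ⟨⟨0, hn⟩⟩
    infer_instance
  have hfin : Module.finrank ℝ (E n) = n := by simp
  have hmp := (volume : Measure (E n)).measurePreserving_homeomorphUnitSphereProd
  rw [hfin] at hmp
  have e1 : ∫⁻ x, Φ x * G ‖x‖ = ∫⁻ x : ({0}ᶜ : Set (E n)), Φ x * G ‖(x : E n)‖
      ∂((volume : Measure (E n)).comap (↑)) := by
    rw [lintegral_subtype_comap (measurableSet_singleton _).compl fun x => Φ x * G ‖x‖,
      restrict_compl_singleton]
  have e2 : ∫⁻ x : ({0}ᶜ : Set (E n)), Φ x * G ‖(x : E n)‖ ∂((volume : Measure (E n)).comap (↑))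
      = ∫⁻ z : Metric.sphere (0 : E n) 1 × Ioi (0 : ℝ),
        Φ z.1 * (ENNReal.ofReal ((z.2 : ℝ) ^ q) * G z.2)
        ∂((volume : Measure (E n)).toSphere.prod (Measure.volumeIoiPow (n - 1))) := by
    rw [← hmp.lintegral_comp (by fun_prop)]
    refine lintegral_congr fun x => ?_
    have hx : 0 < ‖(x : E n)‖ := norm_pos_iff.2 x.2
    simp only [homeomorphUnitSphereProd_apply_fst_coe, homeomorphUnitSphereProd_apply_snd_coe]
    rw [← mul_assoc, mul_comm (Φ (‖(x : E n)‖⁻¹ • (x : E n))), ← hq _ hx, smul_smul, mul_inv_cancel₀ hx.ne', one_smul]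
  rw [e1, e2, lintegral_prod_mul (f := fun θ : Metric.sphere (0 : E n) 1 => Φ θ)
    (g := fun r : Ioi (0 : ℝ) => ENNReal.ofReal ((r : ℝ) ^ q) * G r)
    (by fun_prop) (by fun_prop), lintegral_volumeIoiPow (n - 1)
    (G := fun r => ENNReal.ofReal (r ^ q) * G r) (by fun_prop)]
  congr 1
  refine setLIntegral_congr_fun measurableSet_Ioi fun r (hr : 0 < r) => ?_
  rw [ENNReal.ofReal_mul (by positivity), mul_assoc]

theorem integrableOn_radial {a : ℝ} (ha : 0 < a) :
    IntegrableOn (fun r : ℝ => r ^ (a - 1) * Real.exp (-(1 / 2) * r ^ (2 : ℝ))) (Ioi 0) :=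
  integrableOn_rpow_mul_exp_neg_mul_rpow (by linarith) (by norm_num) (by norm_num)

theorem integral_radial_add_two {a : ℝ} (ha : 0 < a) :
    ∫ r in Ioi (0 : ℝ), r ^ (a + 2 - 1) * Real.exp (-(1 / 2) * r ^ (2 : ℝ)) =
      a * ∫ r in Ioi (0 : ℝ), r ^ (a - 1) * Real.exp (-(1 / 2) * r ^ (2 : ℝ)) := by
  rw [integral_rpow_mul_exp_neg_mul_rpow (by norm_num) (by linarith) (by norm_num),
    integral_rpow_mul_exp_neg_mul_rpow (by norm_num) (by linarith) (by norm_num)]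
  rw [show (a + 2 - 1 + 1) / 2 = a / 2 + 1 by ring, show (a - 1 + 1) / 2 = a / 2 by ring,
    Real.Gamma_add_one (by positivity), show -(a + 2 - 1 + 1) / 2 = -(a - 1 + 1) / 2 + (-1) by ring,
    Real.rpow_add (by norm_num)]
  rw [Real.rpow_neg_one]
  ring

theorem integral_radial_pos {a : ℝ} (ha : 0 < a) :
    0 < ∫ r in Ioi (0 : ℝ), r ^ (a - 1) * Real.exp (-(1 / 2) * r ^ (2 : ℝ)) := by
  rw [integral_rpow_mul_exp_neg_mul_rpow (by norm_num) (by linarith) (by norm_num)]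
  have := Real.Gamma_pos_of_pos (s := (a - 1 + 1) / 2) (by linarith)
  positivity

theorem rpow_mul_integral_radial_le {a p : ℝ} (ha : 0 < a) (hp : 2 ≤ p) :
    a ^ (p / 2) * (∫ r in Ioi (0 : ℝ), r ^ (a - 1) * Real.exp (-(1 / 2) * r ^ (2 : ℝ))) ≤
      ∫ r in Ioi (0 : ℝ), r ^ (a + p - 1) * Real.exp (-(1 / 2) * r ^ (2 : ℝ)) := by
  have i0 := integrableOn_radial ha
  have i2 := integrableOn_radial (show 0 < a + 2 by linarith)
  have ip := integrableOn_radial (show 0 < a + p by linarith)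
  have key := setIntegral_mono_on ((i0.const_mul (a ^ (p / 2) * (1 - p / 2))).add
    (i2.const_mul (a ^ (p / 2) * (p / 2 / a)))) ip measurableSet_Ioi (fun r (hr : 0 < r) => by
      have hb := one_add_mul_self_le_rpow_one_add (s := r ^ 2 / a - 1) (p := p / 2)
        (by have : 0 ≤ r ^ 2 / a := by positivity
            linarith) (by linarith)
      rw [add_sub_cancel, Real.div_rpow (by positivity) ha.le, le_div_iff₀ (by positivity),
        ← Real.rpow_natCast, ← Real.rpow_mul hr.le] at hb
      rw [show ((2 : ℕ) : ℝ) * (p / 2) = p by push_cast; ring] at hb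
      have e2 : r ^ (a + 2 - 1) = r ^ (a - 1) * r ^ ((2 : ℕ) : ℝ) := by
        rw [← Real.rpow_add hr]; congr 1; push_cast; ring
      have ep : r ^ (a + p - 1) = r ^ (a - 1) * r ^ p := by
        rw [← Real.rpow_add hr]; congr 1; ring
      simp only [Pi.add_apply]
      rw [e2, ep]
      have hw : 0 ≤ r ^ (a - 1) * Real.exp (-(1 / 2) * r ^ (2 : ℝ)) := by positivity
      have := mul_le_mul_of_nonneg_left hb hw
      calc _ = _ := by ring
        _ ≤ _ := this
        _ = _ := by ring)
  simp only [Pi.add_apply] at key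
  rw [integral_add (i0.const_mul _) (i2.const_mul _), integral_const_mul, integral_const_mul,
    integral_radial_add_two ha] at key
  refine le_trans (le_of_eq ?_) key
  field_simp
  ring

/-- The radial Gaussian integral in dimension `n`, with an additional weight `r ^ q`. -/
def radialGaussian (n : ℕ) (q : ℝ) : ℝ≥0∞ :=
  ∫⁻ r in Ioi (0 : ℝ), ENNReal.ofReal (r ^ (n - 1) * r ^ q) *
    ENNReal.ofReal (Real.exp (-(1 / 2) * r ^ (2 : ℝ)))

theorem radialGaussian_eq {n : ℕ} (hn : 1 ≤ n) {q : ℝ} (hq : 0 ≤ q) :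
    radialGaussian n q =
      ENNReal.ofReal (∫ r in Ioi (0 : ℝ), r ^ (n + q - 1) * Real.exp (-(1 / 2) * r ^ (2 : ℝ))) := by
  have hn' : (1 : ℝ) ≤ n := by exact_mod_cast hn
  rw [ofReal_integral_eq_lintegral_ofReal (integrableOn_radial (by linarith)), radialGaussian]
  · refine setLIntegral_congr_fun measurableSet_Ioi fun r (hr : 0 < r) => ?_
    rw [← ENNReal.ofReal_mul (by positivity), ← Real.rpow_natCast, ← Real.rpow_add hr,
      Nat.cast_sub hn]
    congr 3
    push_cast
    ring
  · filter_upwards [ae_restrict_mem measurableSet_Ioi] with r hr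
    have : (0 : ℝ) < r := hr
    positivity

theorem radialGaussian_zero_ne_zero {n : ℕ} (hn : 1 ≤ n) : radialGaussian n 0 ≠ 0 := by
  rw [radialGaussian_eq hn le_rfl, add_zero]
  exact (ENNReal.ofReal_pos.2 (integral_radial_pos (by exact_mod_cast hn))).ne'

theorem radialGaussian_zero_ne_top {n : ℕ} (hn : 1 ≤ n) : radialGaussian n 0 ≠ ⊤ := by
  rw [radialGaussian_eq hn le_rfl]
  simp

theorem rpow_mul_radialGaussian_le {n : ℕ} (hn : 1 ≤ n) {p : ℝ} (hp : 2 ≤ p) :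
    ENNReal.ofReal ((n : ℝ) ^ (p / 2)) * radialGaussian n 0 ≤ radialGaussian n p := by
  rw [radialGaussian_eq hn le_rfl, radialGaussian_eq hn (by linarith), add_zero,
    ← ENNReal.ofReal_mul (by positivity)]
  exact ENNReal.ofReal_le_ofReal (rpow_mul_integral_radial_le (by exact_mod_cast hn) hp)

theorem lintegral_gaussian_shift {n : ℕ} (w : E n) :
    ∫⁻ x : E n, ENNReal.ofReal (Real.exp ⟪x, w⟫) *
        ENNReal.ofReal (Real.exp (-(1 / 2) * ‖x‖ ^ (2 : ℝ)))
      = ENNReal.ofReal (Real.exp (‖w‖ ^ 2 / 2)) *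
        ∫⁻ x : E n, ENNReal.ofReal (Real.exp (-(1 / 2) * ‖x‖ ^ (2 : ℝ))) := by
  rw [← lintegral_const_mul' _ _ (by simp), ← lintegral_sub_right_eq_self
    (fun x : E n => ENNReal.ofReal (Real.exp (‖w‖ ^ 2 / 2)) *
      ENNReal.ofReal (Real.exp (-(1 / 2) * ‖x‖ ^ (2 : ℝ)))) w]
  refine lintegral_congr fun x => ?_
  rw [← ENNReal.ofReal_mul (by positivity), ← ENNReal.ofReal_mul (by positivity), ← Real.exp_add,
    ← Real.exp_add]
  congr 2
  simp only [Real.rpow_two]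
  rw [norm_sub_sq_real]
  ring

theorem rpow_le_mul_exp {p y : ℝ} (hp : 0 < p) (hy : 0 ≤ y) :
    y ^ p ≤ p ^ p * Real.exp (-p) * Real.exp y := by
  have h1 : y / p ≤ Real.exp (y / p - 1) := by
    have := Real.add_one_le_exp (y / p - 1)
    linarith
  have h2 := Real.rpow_le_rpow (by positivity) h1 hp.le
  rw [Real.div_rpow hy hp.le, div_le_iff₀ (by positivity), ← Real.exp_mul] at h2
  rw [mul_assoc, ← Real.exp_add]
  refine h2.trans_eq ?_
  rw [mul_comm]
  congr 2
  field_simp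
  ring

theorem lintegral_abs_inner_rpow_gaussian_le {n : ℕ} {p : ℝ} (hp : 0 < p) {v : E n}
    (hv : ‖v‖ = 1) :
    ∫⁻ x : E n, ENNReal.ofReal (|⟪x, v⟫| ^ p) *
        ENNReal.ofReal (Real.exp (-(1 / 2) * ‖x‖ ^ (2 : ℝ)))
      ≤ ENNReal.ofReal (2 * p ^ (p / 2)) *
        ∫⁻ x : E n, ENNReal.ofReal (Real.exp (-(1 / 2) * ‖x‖ ^ (2 : ℝ))) := by
  set G : E n → ℝ≥0∞ := fun x => ENNReal.ofReal (Real.exp (-(1 / 2) * ‖x‖ ^ (2 : ℝ))) with hG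
  have hGm : Measurable G := by
    have : Measurable fun x : E n => -(1 / 2) * ‖x‖ ^ (2 : ℝ) := by fun_prop
    exact (Real.measurable_exp.comp this).ennreal_ofReal
  have hsp : 0 < √p := Real.sqrt_pos.2 hp
  have hsp2 : √p ^ p = p ^ (p / 2) := by
    rw [Real.sqrt_eq_rpow, ← Real.rpow_mul hp.le]; congr 1; ring
  have hpp : p ^ p = p ^ (p / 2) * p ^ (p / 2) := by rw [← Real.rpow_add hp]; congr 1; ring
  have pw : ∀ x : E n, |⟪x, v⟫| ^ p ≤ p ^ (p / 2) * Real.exp (-p) *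
      (Real.exp ⟪x, √p • v⟫ + Real.exp ⟪x, -(√p • v)⟫) := by
    intro x
    have h1 := rpow_le_mul_exp hp (y := √p * |⟪x, v⟫|) (by positivity)
    rw [Real.mul_rpow hsp.le (abs_nonneg _), hsp2, hpp, mul_assoc, mul_assoc] at h1
    have h2 := le_of_mul_le_mul_left h1 (by positivity)
    rw [mul_assoc]
    refine h2.trans ?_
    gcongr
    rw [inner_neg_right, real_inner_smul_right]
    rcases abs_cases ⟪x, v⟫ with ⟨h, _⟩ | ⟨h, _⟩ <;> rw [h]
    · linarith [Real.exp_pos (-(√p * ⟪x, v⟫))]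
    · rw [mul_neg]
      linarith [Real.exp_pos (√p * ⟪x, v⟫)]
  have hw : ‖√p • v‖ ^ 2 = p := by
    rw [norm_smul, hv, mul_one, Real.norm_of_nonneg hsp.le, Real.sq_sqrt hp.le]
  calc _ ≤ ∫⁻ x, ENNReal.ofReal (p ^ (p / 2) * Real.exp (-p)) *
        (ENNReal.ofReal (Real.exp ⟪x, √p • v⟫) * G x
          + ENNReal.ofReal (Real.exp ⟪x, -(√p • v)⟫) * G x) := by
        refine lintegral_mono fun x => ?_
        rw [← add_mul, ← ENNReal.ofReal_add (by positivity) (by positivity), ← mul_assoc,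
          ← ENNReal.ofReal_mul (p := p ^ (p / 2) * Real.exp (-p)) (by positivity)]
        exact mul_le_mul_left (ENNReal.ofReal_le_ofReal (pw x)) _
    _ = ENNReal.ofReal (p ^ (p / 2) * Real.exp (-p) * (2 * Real.exp (p / 2))) * ∫⁻ x, G x := by
        rw [lintegral_const_mul' _ _ (by simp), lintegral_add_right _ (by fun_prop),
          lintegral_gaussian_shift, lintegral_gaussian_shift, norm_neg, hw, ← add_mul,
          ← ENNReal.ofReal_add (by positivity) (by positivity), ← mul_assoc,
          ← ENNReal.ofReal_mul (by positivity)]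
        congr 2
        ring
    _ ≤ _ := by
        refine mul_le_mul_left (ENNReal.ofReal_le_ofReal ?_) _
        have : Real.exp (-p) * Real.exp (p / 2) ≤ 1 := by
          rw [← Real.exp_add]
          exact Real.exp_le_one_iff.2 (by linarith)
        have h0 : 0 ≤ p ^ (p / 2) := by positivity
        nlinarith

theorem lintegral_toSphere_mul_radialGaussian {n : ℕ} (hn : 1 ≤ n) {Φ : E n → ℝ≥0∞}
    (hΦ : Measurable Φ) (q : ℝ)
    (hq : ∀ r : ℝ, 0 < r → ∀ x, Φ (r • x) = ENNReal.ofReal (r ^ q) * Φ x) :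
    (∫⁻ θ : Metric.sphere (0 : E n) 1, Φ θ ∂(volume : Measure (E n)).toSphere) * radialGaussian n q
      = ∫⁻ x, Φ x * ENNReal.ofReal (Real.exp (-(1 / 2) * ‖x‖ ^ (2 : ℝ))) := by
  rw [radialGaussian]
  refine (lintegral_homogeneous_mul_radial hn hΦ (G := fun r =>
    ENNReal.ofReal (Real.exp (-(1 / 2) * r ^ (2 : ℝ)))) ?_ q hq).symm
  have : Measurable fun x : ℝ => -(1 / 2) * x ^ (2 : ℝ) := by fun_prop
  exact (Real.measurable_exp.comp this).ennreal_ofReal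

theorem abs_inner_rpow_homogeneous {n : ℕ} (v : E n) (p r : ℝ) (hr : 0 < r) (x : E n) :
    ENNReal.ofReal (|⟪r • x, v⟫| ^ p) = ENNReal.ofReal (r ^ p) * ENNReal.ofReal (|⟪x, v⟫| ^ p) := by
  rw [← ENNReal.ofReal_mul (by positivity), real_inner_smul_left, abs_mul, abs_of_pos hr,
    Real.mul_rpow hr.le (abs_nonneg _)]

theorem isProbabilityMeasure_sphereProb {n : ℕ} (hn : 1 ≤ n) :
    IsProbabilityMeasure (sphereProb n) := by
  have : Nonempty (Fin n) := ⟨⟨0, hn⟩⟩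
  refine ⟨?_⟩
  rw [sphereProb, Measure.smul_apply, smul_eq_mul]
  exact ENNReal.inv_mul_cancel (Measure.measure_univ_ne_zero.2 (Measure.toSphere_ne_zero (volume : Measure (E n))))
    (measure_ne_top _ _)

theorem lintegral_sphereProb_inner_le_of_norm_eq_one {n : ℕ} (hn : 1 ≤ n) {p : ℝ} (hp : 2 ≤ p)
    {v : E n} (hv : ‖v‖ = 1) :
    ∫⁻ θ : Metric.sphere (0 : E n) 1, ENNReal.ofReal (|⟪(θ : E n), v⟫| ^ p) ∂(sphereProb n)
      ≤ ENNReal.ofReal (2 * √(p / n) ^ p) := by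
  have hn0 : (0 : ℝ) < n := by exact_mod_cast hn
  have h1 := lintegral_toSphere_mul_radialGaussian hn
    (Φ := fun x => ENNReal.ofReal (|⟪x, v⟫| ^ p)) (by fun_prop) p
    (fun r hr x => abs_inner_rpow_homogeneous v p r hr x)
  have h2 := lintegral_toSphere_mul_radialGaussian hn (n := n) (Φ := fun x => 1) (by fun_prop) 0
    (by simp)
  simp only [lintegral_one, one_mul] at h2
  have h3 := lintegral_abs_inner_rpow_gaussian_le (n := n) (p := p) (by linarith) hv
  rw [← h1, ← h2] at h3
  have h4 := (mul_le_mul_right (rpow_mul_radialGaussian_le hn hp) _).trans h3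
  rw [← mul_assoc, ← mul_assoc, ENNReal.mul_le_mul_iff_left (radialGaussian_zero_ne_zero hn)
    (radialGaussian_zero_ne_top hn)] at h4
  have : Nonempty (Fin n) := ⟨⟨0, hn⟩⟩
  have hS0 : (volume : Measure (E n)).toSphere univ ≠ 0 :=
    Measure.measure_univ_ne_zero.2 (Measure.toSphere_ne_zero (volume : Measure (E n)))
  have hc : 0 < (n : ℝ) ^ (p / 2) := by positivity
  rw [sphereProb, lintegral_smul_measure, smul_eq_mul, mul_comm, ← div_eq_mul_inv,
    ENNReal.div_le_iff hS0 (measure_ne_top _ _)]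
  rw [← ENNReal.le_div_iff_mul_le (by simp [hc]) (by simp)] at h4
  refine h4.trans_eq ?_
  rw [ENNReal.mul_div_right_comm, ← ENNReal.ofReal_div_of_pos hc]
  congr 2
  rw [Real.sqrt_eq_rpow, ← Real.rpow_mul (by positivity), Real.div_rpow (by linarith) hn0.le,
    show 1 / 2 * p = p / 2 by ring]
  ring

theorem lintegral_sphereProb_inner_le_of_two_le {n : ℕ} (hn : 1 ≤ n) {p : ℝ} (hp : 2 ≤ p)
    (v : E n) :
    ∫⁻ θ : Metric.sphere (0 : E n) 1, ENNReal.ofReal (|⟪(θ : E n), v⟫| ^ p) ∂(sphereProb n)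
      ≤ ENNReal.ofReal ((2 * √(p / n) * ‖v‖) ^ p) := by
  rcases eq_or_ne v 0 with rfl | hv
  · have : (0 : ℝ) ^ p = 0 := Real.zero_rpow (by linarith)
    simp [this]
  have hv0 : 0 < ‖v‖ := norm_pos_iff.2 hv
  have h := lintegral_sphereProb_inner_le_of_norm_eq_one hn hp (v := ‖v‖⁻¹ • v) (by
    rw [norm_smul, norm_inv, norm_norm, inv_mul_cancel₀ hv0.ne'])
  calc _ = ENNReal.ofReal (‖v‖ ^ p) * ∫⁻ θ : Metric.sphere (0 : E n) 1,
        ENNReal.ofReal (|⟪(θ : E n), ‖v‖⁻¹ • v⟫| ^ p) ∂(sphereProb n) := by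
        rw [← lintegral_const_mul' _ _ (by simp)]
        refine lintegral_congr fun θ => ?_
        rw [← ENNReal.ofReal_mul (by positivity), ← Real.mul_rpow hv0.le (abs_nonneg _),
          real_inner_smul_right, abs_mul, abs_inv, abs_norm, mul_inv_cancel_left₀ hv0.ne']
    _ ≤ ENNReal.ofReal (‖v‖ ^ p) * ENNReal.ofReal (2 * √(p / n) ^ p) := by gcongr
    _ ≤ _ := by
        rw [← ENNReal.ofReal_mul (by positivity)]
        refine ENNReal.ofReal_le_ofReal ?_
        rw [Real.mul_rpow (by positivity) (by positivity), Real.mul_rpow (by positivity)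
          (by positivity), mul_comm]
        have : (2 : ℝ) ≤ 2 ^ p := by
          simpa using Real.rpow_le_rpow_of_exponent_le (x := 2) (by norm_num)
            (show 1 ≤ p by linarith)
        gcongr

theorem abs_inner_sphere_le {n : ℕ} (θ : Metric.sphere (0 : E n) 1) (v : E n) :
    |⟪(θ : E n), v⟫| ≤ ‖v‖ := by
  simpa using abs_real_inner_le_norm (θ : E n) v

/-- The `p`-th moment of a linear functional on the sphere. -/
theorem lintegral_sphereProb_inner_le {n : ℕ} (hn : 1 ≤ n) {p : ℝ} (hp : 0 < p) (v : E n) :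
    ∫⁻ θ : Metric.sphere (0 : E n) 1, ENNReal.ofReal (|⟪(θ : E n), v⟫| ^ p) ∂(sphereProb n)
      ≤ ENNReal.ofReal ((3 * √(max 1 (min p n) / n) * ‖v‖) ^ p) := by
  have hn0 : (1 : ℝ) ≤ n := by exact_mod_cast hn
  have := isProbabilityMeasure_sphereProb hn
  rcases le_total 2 p with h2 | h2
  · rcases le_total p n with hpn | hpn
    · refine (lintegral_sphereProb_inner_le_of_two_le hn h2 v).trans (ENNReal.ofReal_le_ofReal ?_)
      rw [min_eq_left hpn, max_eq_right (by linarith)]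
      gcongr
      norm_num
    · rw [min_eq_right hpn, max_eq_right hn0, div_self (by linarith), Real.sqrt_one]
      calc _ ≤ ∫⁻ θ : Metric.sphere (0 : E n) 1, ENNReal.ofReal ((3 * 1 * ‖v‖) ^ p)
            ∂(sphereProb n) := by
            refine lintegral_mono fun θ => ENNReal.ofReal_le_ofReal ?_
            refine Real.rpow_le_rpow (abs_nonneg _) ?_ hp.le
            linarith [abs_inner_sphere_le θ v, norm_nonneg v]
        _ = _ := by simp
  · have hJ := eLpNorm'_le_eLpNorm'_of_exponent_le (μ := sphereProb n) hp h2
      (f := fun θ : Metric.sphere (0 : E n) 1 => ⟪(θ : E n), v⟫) (by fun_prop)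
    have e : ∀ q : ℝ, 0 < q → ∀ θ : Metric.sphere (0 : E n) 1, ‖⟪(θ : E n), v⟫‖ₑ ^ q
        = ENNReal.ofReal (|⟪(θ : E n), v⟫| ^ q) := by
      intro q hq θ
      rw [← Real.norm_eq_abs, ← ENNReal.ofReal_rpow_of_nonneg (norm_nonneg _) hq.le, ofReal_norm]
    rw [eLpNorm', eLpNorm'] at hJ
    simp_rw [e p hp, e 2 (by norm_num)] at hJ
    have h2' := lintegral_sphereProb_inner_le_of_two_le hn le_rfl v
    rw [← ENNReal.ofReal_rpow_of_nonneg (by positivity) (by norm_num)] at h2'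
    have h3 := hJ.trans (ENNReal.rpow_le_rpow h2' (by norm_num : (0 : ℝ) ≤ 1 / 2))
    rw [← ENNReal.rpow_mul, mul_one_div_cancel two_ne_zero, ENNReal.rpow_one,
      one_div, ENNReal.rpow_inv_le_iff hp] at h3
    refine h3.trans ?_
    rw [ENNReal.ofReal_rpow_of_nonneg (by positivity) hp.le]
    refine ENNReal.ofReal_le_ofReal (Real.rpow_le_rpow (by positivity) ?_ hp.le)
    have h5 : 2 * √(2 / (n : ℝ)) ≤ 3 * √(max 1 (min p n) / n) := by
      have h6 : √(1 / (n : ℝ)) ≤ √(max 1 (min p n) / n) := by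
        apply Real.sqrt_le_sqrt
        gcongr
        exact le_max_left _ _
      have h7 : √(2 / (n : ℝ)) = √2 * √(1 / (n : ℝ)) := by
        rw [← Real.sqrt_mul (by norm_num)]; congr 1; ring
      have h8 : √2 ≤ 3 / 2 := by
        rw [Real.sqrt_le_left (by norm_num)]; norm_num
      rw [h7]
      nlinarith [Real.sqrt_nonneg (1 / (n : ℝ)), Real.sqrt_nonneg 2]
    gcongr

theorem ae_sphereProb_inner_ne_zero {n : ℕ} (hn : 1 ≤ n) {v : E n} (hv : v ≠ 0) :
    ∀ᵐ θ : Metric.sphere (0 : E n) 1 ∂(sphereProb n), ⟪(θ : E n), v⟫ ≠ 0 := by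
  have hm : MeasurableSet {x : E n | ⟪x, v⟫ = 0} :=
    measurableSet_eq_fun (by fun_prop) (by fun_prop)
  have h1 := lintegral_toSphere_mul_radialGaussian hn
    (Φ := {x : E n | ⟪x, v⟫ = 0}.indicator 1) (measurable_one.indicator hm) 0 (by
      intro r hr x
      simp [indicator, real_inner_smul_left, hr.ne'])
  have h0 : volume {x : E n | ⟪x, v⟫ = 0} = 0 := by
    have := Measure.addHaar_submodule (volume : Measure (E n)) (LinearMap.ker (innerSL ℝ v).toLinearMap) (by
      intro h
      have : v ∈ LinearMap.ker (innerSL ℝ v).toLinearMap := by rw [h]; trivial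
      simp at this
      exact hv this)
    convert this using 2
    ext x
    simp [real_inner_comm]
  have h2 : ∫⁻ x : E n, {x : E n | ⟪x, v⟫ = 0}.indicator 1 x *
      ENNReal.ofReal (Real.exp (-(1 / 2) * ‖x‖ ^ (2 : ℝ))) = 0 := by
    rw [lintegral_eq_zero_of_ae_eq_zero]
    have : ∀ᵐ x : E n, x ∉ {x : E n | ⟪x, v⟫ = 0} := measure_eq_zero_iff_ae_notMem.1 h0
    filter_upwards [this] with x (hx : x ∉ {x : E n | ⟪x, v⟫ = 0})
    rw [indicator_of_notMem hx]
    simp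
  rw [h2, mul_eq_zero, or_iff_left (radialGaussian_zero_ne_zero hn)] at h1
  rw [ae_iff, sphereProb, Measure.smul_apply, smul_eq_mul]
  refine mul_eq_zero_of_right _ ?_
  rw [← h1, ← lintegral_indicator_one]
  · refine lintegral_congr fun θ => ?_
    simp [indicator]
  · exact (hm.preimage measurable_subtype_coe).congr (by ext; simp)

/-! ### Sections of `L_p` -/

/-- `K` is a centrally symmetric convex body whose normalized second moments are at least `τ²` in
every direction. -/
structure IsSymmBody {n : ℕ} (K : Set (E n)) (τ : ℝ) : Prop where
  isCompact : IsCompact K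
  convex : Convex ℝ K
  symm : ∀ x ∈ K, -x ∈ K
  ball_subset : ∃ ε > 0, Metric.closedBall (0 : E n) ε ⊆ K
  pos : 0 < τ
  secondMoment : ∀ v : E n, ENNReal.ofReal ((τ * ‖v‖) ^ 2) * volume K ≤
    ∫⁻ x in K, ENNReal.ofReal (⟪x, v⟫ ^ 2)

namespace IsSymmBody

variable {n : ℕ} {K : Set (E n)} {τ : ℝ}

theorem volume_ne_top (h : IsSymmBody K τ) : volume K ≠ ⊤ := h.isCompact.measure_ne_top

theorem isFiniteMeasure (h : IsSymmBody K τ) : IsFiniteMeasure (volume.restrict K) :=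
  isFiniteMeasure_restrict.2 h.volume_ne_top

theorem volume_ne_zero (h : IsSymmBody K τ) : volume K ≠ 0 := by
  obtain ⟨ε, hε, hK⟩ := h.ball_subset
  exact ((Metric.measure_closedBall_pos volume (0 : E n) hε).trans_le (measure_mono hK)).ne'

theorem measureReal_pos (h : IsSymmBody K τ) : 0 < (volume.restrict K).real univ := by
  rw [measureReal_restrict_apply_univ]
  exact ENNReal.toReal_pos h.volume_ne_zero h.volume_ne_top

theorem isSymmLogConcave (h : IsSymmBody K τ) (v : E n) :
    IsSymmLogConcave (volume.restrict K) (fun x => ⟪x, v⟫) :=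
  isSymmLogConcave_inner h.isCompact.measurableSet h.convex h.symm v

theorem secondMoment_restrict (h : IsSymmBody K τ) (v : E n) :
    ENNReal.ofReal ((τ * ‖v‖) ^ 2) * volume.restrict K univ ≤
      ∫⁻ x in K, ENNReal.ofReal (⟪x, v⟫ ^ 2) := by
  rw [Measure.restrict_apply_univ]
  exact h.secondMoment v

theorem le_lintegral_rpow (h : IsSymmBody K τ) (v : E n) {p : ℝ} (hp : 0 < p) :
    ENNReal.ofReal ((τ / 49) ^ p) * ENNReal.ofReal (‖v‖ ^ p) * volume K ≤
      ∫⁻ x in K, ENNReal.ofReal (|⟪x, v⟫| ^ p) := by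
  have := h.isFiniteMeasure
  have hτ := h.pos
  rcases eq_or_ne v 0 with rfl | hv
  · simp [Real.zero_rpow hp.ne']
  have hv0 : 0 < ‖v‖ := norm_pos_iff.2 hv
  have := (h.isSymmLogConcave v).le_lintegral_rpow h.measureReal_pos (mul_pos hτ hv0)
    (h.secondMoment_restrict v) hp
  rw [Measure.restrict_apply_univ, mul_div_right_comm, Real.mul_rpow (by positivity) (by positivity),
    ENNReal.ofReal_mul (by positivity)] at this
  exact this

theorem integrable_inner (h : IsSymmBody K τ) (v : E n) :
    Integrable (fun x => ⟪x, v⟫) (volume.restrict K) :=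
  (Continuous.continuousOn (by fun_prop)).integrableOn_compact h.isCompact

theorem integrable_log (h : IsSymmBody K τ) {v : E n} (hv : ‖v‖ = 1) :
    Integrable (fun x => Real.log |⟪x, v⟫|) (volume.restrict K) := by
  have := h.isFiniteMeasure
  have hm := h.secondMoment_restrict v
  rw [hv, mul_one] at hm
  exact (h.isSymmLogConcave v).integrable_log h.measureReal_pos h.pos hm (h.integrable_inner v)

theorem le_integral_log (h : IsSymmBody K τ) {v : E n} (hv : ‖v‖ = 1) :
    volume.real K * Real.log (τ / 49) ≤ ∫ x in K, Real.log |⟪x, v⟫| := by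
  have := h.isFiniteMeasure
  have hm := h.secondMoment_restrict v
  rw [hv, mul_one] at hm
  have := (h.isSymmLogConcave v).le_integral_log h.measureReal_pos h.pos hm (h.integrable_inner v)
  rwa [measureReal_restrict_apply_univ] at this

theorem exists_integral_abs_log_le (h : IsSymmBody K τ) :
    ∃ M : ℝ, ∀ v : E n, ‖v‖ = 1 → ∫ x in K, |(Real.log |⟪x, v⟫|)| ≤ M := by
  have := h.isFiniteMeasure
  obtain ⟨R, hR⟩ := h.isCompact.isBounded.subset_closedBall (0 : E n)
  refine ⟨(∫ x in K, R) + 14 * τ ^ (-(1 / 2) : ℝ) * (volume.restrict K).real univ,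
    fun v hv => ?_⟩
  have hm := h.secondMoment_restrict v
  rw [hv, mul_one] at hm
  refine ((h.isSymmLogConcave v).integral_abs_log_le h.measureReal_pos h.pos hm
    (h.integrable_inner v)).trans ?_
  refine add_le_add_left ?_ _
  refine setIntegral_mono_on (h.integrable_inner v).abs (integrable_const _)
    h.isCompact.measurableSet fun x hx => ?_
  have h1 := abs_real_inner_le_norm x v
  have h2 := hR hx
  rw [mem_closedBall_zero_iff] at h2
  rw [hv, mul_one] at h1
  exact h1.trans h2

theorem exists_lintegral_sphere_rpow_neg_half_le (h : IsSymmBody K τ) (hn : 1 ≤ n) :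
    ∃ M : ℝ≥0∞, M ≠ ⊤ ∧ ∀ v : E n, ‖v‖ = 1 →
      ∫⁻ θ : Metric.sphere (0 : E n) 1, ENNReal.ofReal (|⟪(θ : E n), v⟫| ^ (-(1 / 2) : ℝ))
        ∂(sphereProb n) ≤ M := by
  have := h.isFiniteMeasure
  obtain ⟨ε, hε, hK⟩ := h.ball_subset
  set κ : ℝ≥0∞ := ∫⁻ r in Ioi (0 : ℝ), ENNReal.ofReal (r ^ (n - 1) * r ^ (-(1 / 2) : ℝ)) *
    (Iic ε).indicator 1 r with hκ
  have hGm : Measurable ((Iic ε).indicator (1 : ℝ → ℝ≥0∞)) :=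
    measurable_one.indicator measurableSet_Iic
  have hκ0 : κ ≠ 0 := by
    rw [hκ]
    refine (setLIntegral_pos_iff (by fun_prop)).2 ?_ |>.ne'
    refine lt_of_lt_of_le ?_ (measure_mono (s := Ioc 0 ε) ?_)
    · simp [hε]
    · intro r hr
      have h1 : 0 < r := hr.1
      refine ⟨?_, h1⟩
      rw [Function.mem_support, indicator_of_mem (show r ∈ Iic ε from hr.2)]
      have : 0 < r ^ (n - 1) * r ^ (-(1 / 2) : ℝ) := by positivity
      simpa using this
  have hnt : Nonempty (Fin n) := ⟨⟨0, hn⟩⟩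
  have hS0 : (volume : Measure (E n)).toSphere univ ≠ 0 :=
    Measure.measure_univ_ne_zero.2 (Measure.toSphere_ne_zero (volume : Measure (E n)))
  have hA : ENNReal.ofReal (7 * τ ^ (-(1 / 2) : ℝ)) * volume.restrict K univ ≠ ⊤ :=
    ENNReal.mul_ne_top ENNReal.ofReal_ne_top (measure_ne_top _ _)
  refine ⟨((volume : Measure (E n)).toSphere univ)⁻¹ *
    (ENNReal.ofReal (7 * τ ^ (-(1 / 2) : ℝ)) * volume.restrict K univ / κ),
    ENNReal.mul_ne_top (by simpa using hS0) (ENNReal.div_ne_top hA hκ0), fun v hv => ?_⟩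
  rw [sphereProb, lintegral_smul_measure, smul_eq_mul]
  gcongr
  rw [ENNReal.le_div_iff_mul_le (Or.inl hκ0) (Or.inr hA)]
  have hm := h.secondMoment_restrict v
  rw [hv, mul_one] at hm
  refine le_trans ?_ ((h.isSymmLogConcave v).lintegral_rpow_neg_half_le h.measureReal_pos h.pos hm)
  rw [← lintegral_homogeneous_mul_radial hn
    (Φ := fun x => ENNReal.ofReal (|⟪x, v⟫| ^ (-(1 / 2) : ℝ))) (by fun_prop) hGm
    _ (fun r hr x => abs_inner_rpow_homogeneous v _ r hr x),
    ← lintegral_indicator h.isCompact.measurableSet]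
  refine lintegral_mono fun x => ?_
  by_cases hx : ‖x‖ ≤ ε
  · rw [indicator_of_mem (hK (mem_closedBall_zero_iff.2 hx)),
      indicator_of_mem (show ‖x‖ ∈ Iic ε from hx)]
    simp
  · rw [indicator_of_notMem (show ‖x‖ ∉ Iic ε from hx)]
    simp

end IsSymmBody

/-- A linear map into `L_p` is represented by a measurable vector-valued function. -/
theorem exists_ae_eq_inner {n : ℕ} {p : ℝ} (T : E n →ₗ[ℝ] LpUnit p) :
    ∃ v : ℝ → E n, Measurable v ∧
      ∀ x, T x =ᵐ[volume.restrict (Icc (0 : ℝ) 1)] fun t => ⟪x, v t⟫ := by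
  refine ⟨fun t => WithLp.toLp 2 fun i => T (EuclideanSpace.single i 1) t, ?_, fun x => ?_⟩
  · refine (PiLp.continuous_toLp 2 _).measurable.comp (measurable_pi_lambda _ fun i => ?_)
    exact (Lp.stronglyMeasurable _).measurable
  · have hx : T x = ∑ i, x i • T (EuclideanSpace.single i 1) := by
      conv_lhs => rw [← (EuclideanSpace.basisFun (Fin n) ℝ).sum_repr x]
      simp
    rw [hx]
    filter_upwards [Lp.coeFn_fun_finsetSum Finset.univ fun i =>
        x i • T (EuclideanSpace.single i 1), ae_all_iff.2 fun i =>
        Lp.coeFn_smul (x i) (T (EuclideanSpace.single i 1))] with t h1 h2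
    rw [h1]
    simp [h2, PiLp.inner_apply, mul_comm]

theorem lintegral_inner_rpow_eq_norm {n : ℕ} {p : ℝ} (hp : 0 < p) {T : E n →ₗ[ℝ] LpUnit p}
    {v : ℝ → E n} {x : E n} (hv : T x =ᵐ[volume.restrict (Icc (0 : ℝ) 1)] fun t => ⟪x, v t⟫) :
    ∫⁻ t in Icc (0 : ℝ) 1, ENNReal.ofReal (|⟪x, v t⟫| ^ p) = ENNReal.ofReal (‖T x‖ ^ p) := by
  have hp' : ENNReal.ofReal p ≠ 0 := by simpa using hp
  rw [Lp.norm_def, ENNReal.toReal_rpow, ENNReal.ofReal_toReal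
    (ENNReal.rpow_ne_top_of_nonneg hp.le (Lp.eLpNorm_ne_top _)), eLpNorm_congr_ae hv,
    eLpNorm_eq_lintegral_rpow_enorm_toReal hp' ENNReal.ofReal_ne_top, ← ENNReal.rpow_mul,
    ENNReal.toReal_ofReal hp.le, one_div, inv_mul_cancel₀ hp.ne', ENNReal.rpow_one]
  refine lintegral_congr fun t => ?_
  rw [← Real.norm_eq_abs, ← ENNReal.ofReal_rpow_of_nonneg (norm_nonneg _) hp.le, ofReal_norm]

theorem norm_map_smul {n : ℕ} {p : ℝ} (T : E n →ₗ[ℝ] LpUnit p) (r : ℝ) (x : E n) :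
    ‖T (r • x)‖ = |r| * ‖T x‖ := by
  rw [map_smul, Lp.norm_def, Lp.norm_def, eLpNorm_congr_ae (Lp.coeFn_smul r (T x)),
    eLpNorm_const_smul, ENNReal.toReal_mul]
  simp

theorem gauge_section {n : ℕ} {p : ℝ} (T : E n →ₗ[ℝ] LpUnit p) (x : E n) :
    gauge {x | ‖T x‖ ≤ 1} x = ‖T x‖ := by
  have h0 : 0 ≤ ‖T x‖ := ENNReal.toReal_nonneg
  have e : {r : ℝ | 0 < r ∧ x ∈ r • {x | ‖T x‖ ≤ 1}} = {r : ℝ | 0 < r ∧ ‖T x‖ ≤ r} := by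
    ext r
    refine and_congr_right fun hr => ?_
    rw [Set.mem_smul_set_iff_inv_smul_mem₀ hr.ne']
    simp only [mem_ofPred_eq]
    rw [norm_map_smul, abs_inv, abs_of_pos hr, inv_mul_le_iff₀ hr, mul_one]
  rw [gauge_def, show {r ∈ Ioi 0 | x ∈ r • {x | ‖T x‖ ≤ 1}} =
    {r : ℝ | 0 < r ∧ x ∈ r • {x | ‖T x‖ ≤ 1}} from rfl, e]
  refine le_antisymm (le_of_forall_pos_le_add fun ε hε => ?_) ?_
  · exact csInf_le ⟨0, fun r hr => hr.1.le⟩ ⟨by linarith, by linarith⟩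
  · exact le_csInf ⟨‖T x‖ + 1, by linarith, by linarith⟩ fun r hr => hr.2

/-- The main estimate for sections of `L_p` with `p > 0`. -/
theorem IsSymmBody.meanNorm_le_of_pos {n : ℕ} (hn : 1 ≤ n) {K L : Set (E n)} {τ p : ℝ}
    (h : IsSymmBody K τ) (hp : 0 < p) (hL : IsSectionPos p L) (hKL : K ⊆ L) :
    0 < meanNorm p L ∧ τ / 49 * meanNorm p L ≤ 3 * √(max 1 (min p n) / n) := by
  obtain ⟨T, hT, rfl⟩ := hL
  obtain ⟨v, hvm, hv⟩ := exists_ae_eq_inner T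
  have := isProbabilityMeasure_sphereProb hn
  have hτ := h.pos
  set β := 3 * √(max 1 (min p n) / n) with hβ
  set ν := volume.restrict (Icc (0 : ℝ) 1) with hν
  have hN := fun x => lintegral_inner_rpow_eq_norm hp (hv x)
  set V := ∫⁻ t, ENNReal.ofReal (‖v t‖ ^ p) ∂ν with hV
  have hVle : ENNReal.ofReal ((τ / 49) ^ p) * V ≤ 1 := by
    have h1 : ∫⁻ x in K, ENNReal.ofReal (‖T x‖ ^ p) ≤ volume K := by
      calc _ ≤ ∫⁻ x in K, 1 := by
            refine setLIntegral_mono' h.isCompact.measurableSet fun x hx => ?_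
            have := hKL hx
            exact ENNReal.ofReal_le_one.2 (Real.rpow_le_one ENNReal.toReal_nonneg this hp.le)
        _ = _ := by simp
    simp_rw [← hN] at h1
    rw [lintegral_lintegral_swap (by fun_prop)] at h1
    have h2 : ENNReal.ofReal ((τ / 49) ^ p) * V * volume K ≤ volume K := by
      refine le_trans ?_ h1
      rw [hV, ← lintegral_const_mul' _ _ (by simp), ← lintegral_mul_const' _ _ h.volume_ne_top]
      exact lintegral_mono fun t => h.le_lintegral_rpow (v t) hp
    rw [← ENNReal.mul_le_mul_iff_left h.volume_ne_zero h.volume_ne_top, one_mul]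
    exact h2
  have hS : ∫⁻ θ : Metric.sphere (0 : E n) 1, ENNReal.ofReal (‖T θ‖ ^ p) ∂(sphereProb n) ≤
      ENNReal.ofReal (β ^ p) * V := by
    simp_rw [← hN]
    rw [lintegral_lintegral_swap (by fun_prop), hV, ← lintegral_const_mul' _ _ (by simp)]
    refine lintegral_mono fun t => ?_
    refine (lintegral_sphereProb_inner_le hn hp (v t)).trans_eq ?_
    rw [Real.mul_rpow (by positivity) (by positivity), ENNReal.ofReal_mul (by positivity)]
  have hVtop : V ≠ ⊤ := by
    rintro hcon
    rw [hcon, ENNReal.mul_top (by simp; positivity)] at hVle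
    simp at hVle
  have hmeas : Measurable fun θ : Metric.sphere (0 : E n) 1 => ‖T θ‖ ^ p := by
    have : (fun θ : Metric.sphere (0 : E n) 1 => ‖T θ‖ ^ p) = fun θ : Metric.sphere (0 : E n) 1 =>
        (∫⁻ t in Icc (0 : ℝ) 1, ENNReal.ofReal (|⟪(θ : E n), v t⟫| ^ p)).toReal := by
      ext θ
      have h0 : 0 ≤ ‖T θ‖ := ENNReal.toReal_nonneg
      rw [hN, ENNReal.toReal_ofReal (Real.rpow_nonneg h0 _)]
    rw [this]
    refine Measurable.ennreal_toReal (Measurable.lintegral_prod_right' (f := fun z :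
      Metric.sphere (0 : E n) 1 × ℝ => ENNReal.ofReal (|⟪(z.1 : E n), v z.2⟫| ^ p)) ?_)
    fun_prop
  have hpos : ∀ θ : Metric.sphere (0 : E n) 1, 0 < ‖T θ‖ ^ p := by
    intro θ
    have h0 : 0 ≤ ‖T θ‖ := ENNReal.toReal_nonneg
    refine Real.rpow_pos_of_pos (h0.lt_of_ne' fun hcon => ?_) _
    rw [Lp.norm_eq_zero_iff (by simpa using hp), ← map_zero T] at hcon
    revert hcon
    exact hT.ne (ne_zero_of_mem_unit_sphere θ)
  have hint : Integrable (fun θ : Metric.sphere (0 : E n) 1 => ‖T θ‖ ^ p) (sphereProb n) :=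
    (lintegral_ofReal_ne_top_iff_integrable hmeas.aestronglyMeasurable
      (.of_forall fun θ => (hpos θ).le)).1 (ne_top_of_le_ne_top
        (ENNReal.mul_ne_top ENNReal.ofReal_ne_top hVtop) hS)
  have hI : 0 < ∫ θ : Metric.sphere (0 : E n) 1, ‖T θ‖ ^ p ∂(sphereProb n) := by
    rw [integral_pos_iff_support_of_nonneg (fun θ => (hpos θ).le) hint]
    rw [show Function.support (fun θ : Metric.sphere (0 : E n) 1 => ‖T θ‖ ^ p) = univ from
      eq_univ_of_forall fun θ => (hpos θ).ne']
    simp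
  have hM : meanNorm p {x | ‖T x‖ ≤ 1} =
      (∫ θ : Metric.sphere (0 : E n) 1, ‖T θ‖ ^ p ∂(sphereProb n)) ^ (1 / p) := by
    simp_rw [meanNorm, if_neg hp.ne', gauge_section]
  set I := ∫ θ : Metric.sphere (0 : E n) 1, ‖T θ‖ ^ p ∂(sphereProb n) with hIdef
  rw [hM]
  refine ⟨by positivity, ?_⟩
  have key : (τ / 49) ^ p * I ≤ β ^ p := by
    rw [← ENNReal.ofReal_le_ofReal_iff (by positivity), ENNReal.ofReal_mul (by positivity), hIdef,
      ofReal_integral_eq_lintegral_ofReal hint (.of_forall fun θ => (hpos θ).le)]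
    calc _ ≤ ENNReal.ofReal ((τ / 49) ^ p) * (ENNReal.ofReal (β ^ p) * V) := by gcongr
      _ = ENNReal.ofReal (β ^ p) * (ENNReal.ofReal ((τ / 49) ^ p) * V) := by ring
      _ ≤ ENNReal.ofReal (β ^ p) * 1 := by gcongr
      _ = _ := mul_one _
  rw [← Real.rpow_le_rpow_iff (by positivity) (by positivity) hp,
    Real.mul_rpow (by positivity) (by positivity), ← Real.rpow_mul hI.le, one_div,
    inv_mul_cancel₀ hp.ne', Real.rpow_one]
  exact key

theorem IsSymmBody.integrable_log_sphere {n : ℕ} (hn : 1 ≤ n) {K : Set (E n)} {τ : ℝ}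
    (h : IsSymmBody K τ) :
    (∀ v : E n, ‖v‖ = 1 → Integrable (fun θ : Metric.sphere (0 : E n) 1 =>
        Real.log |⟪(θ : E n), v⟫|) (sphereProb n)) ∧
      ∃ M : ℝ, ∀ v : E n, ‖v‖ = 1 →
        ∫ θ : Metric.sphere (0 : E n) 1, |(Real.log |⟪(θ : E n), v⟫|)| ∂(sphereProb n) ≤ M := by
  have := isProbabilityMeasure_sphereProb hn
  obtain ⟨M, hM, hMle⟩ := h.exists_lintegral_sphere_rpow_neg_half_le hn
  have hI : ∀ v : E n, ‖v‖ = 1 → Integrable (fun θ : Metric.sphere (0 : E n) 1 =>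
      |⟪(θ : E n), v⟫| ^ (-(1 / 2) : ℝ)) (sphereProb n) := fun v hv =>
    (lintegral_ofReal_ne_top_iff_integrable (Measurable.aestronglyMeasurable (by fun_prop))
      (.of_forall fun θ => by positivity)).1 (ne_top_of_le_ne_top hM (hMle v hv))
  have hb : ∀ v : E n, ‖v‖ = 1 → ∀ θ : Metric.sphere (0 : E n) 1,
      |(Real.log |⟪(θ : E n), v⟫|)| ≤ 1 + 2 * |⟪(θ : E n), v⟫| ^ (-(1 / 2) : ℝ) := by
    intro v hv θ
    refine (abs_log_le (abs_nonneg _)).trans ?_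
    gcongr
    exact (abs_inner_sphere_le θ v).trans_eq hv
  have hL : ∀ v : E n, ‖v‖ = 1 → Integrable (fun θ : Metric.sphere (0 : E n) 1 =>
      Real.log |⟪(θ : E n), v⟫|) (sphereProb n) := by
    intro v hv
    refine Integrable.mono' ((integrable_const 1).add ((hI v hv).const_mul 2))
      (Real.measurable_log.comp (by fun_prop)).aestronglyMeasurable (.of_forall fun θ => hb v hv θ)
  refine ⟨hL, 1 + 2 * M.toReal, fun v hv => ?_⟩
  refine (integral_mono (hL v hv).abs ((integrable_const 1).add ((hI v hv).const_mul 2))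
    (hb v hv)).trans ?_
  rw [integral_add' (integrable_const 1) ((hI v hv).const_mul 2), integral_const_mul]
  have : ∫ θ : Metric.sphere (0 : E n) 1, |⟪(θ : E n), v⟫| ^ (-(1 / 2) : ℝ) ∂(sphereProb n) ≤
      M.toReal := by
    rw [← ENNReal.ofReal_le_iff_le_toReal hM, ofReal_integral_eq_lintegral_ofReal (hI v hv)
      (.of_forall fun θ => by positivity)]
    exact hMle v hv
  simp
  linarith

theorem integral_log_sphere_le {n : ℕ} (hn : 1 ≤ n) {v : E n} (hv : ‖v‖ = 1)
    (hI : Integrable (fun θ : Metric.sphere (0 : E n) 1 => Real.log |⟪(θ : E n), v⟫|)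
      (sphereProb n)) :
    ∫ θ : Metric.sphere (0 : E n) 1, Real.log |⟪(θ : E n), v⟫| ∂(sphereProb n) ≤
      Real.log (3 * √(1 / n)) := by
  have := isProbabilityMeasure_sphereProb hn
  have hn0 : (0 : ℝ) < n := by exact_mod_cast hn
  set b := 3 * √(1 / (n : ℝ)) with hb
  have hb0 : 0 < b := by positivity
  have h2 := lintegral_sphereProb_inner_le_of_two_le hn le_rfl v
  have hle : (2 * √(2 / (n : ℝ)) * ‖v‖) ^ (2 : ℝ) ≤ b ^ 2 := by
    rw [hv, Real.rpow_two, mul_one, hb, mul_pow, mul_pow, Real.sq_sqrt (by positivity),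
      Real.sq_sqrt (by positivity)]
    field_simp
    norm_num
  simp only [Real.rpow_two] at h2 hle
  have hI2 : Integrable (fun θ : Metric.sphere (0 : E n) 1 => |⟪(θ : E n), v⟫| ^ 2)
      (sphereProb n) :=
    (lintegral_ofReal_ne_top_iff_integrable (Measurable.aestronglyMeasurable (by fun_prop))
      (.of_forall fun θ => by positivity)).1 (ne_top_of_le_ne_top ENNReal.ofReal_ne_top h2)
  rw [← ofReal_integral_eq_lintegral_ofReal hI2 (.of_forall fun θ => by positivity),
    ENNReal.ofReal_le_ofReal_iff (by positivity)] at h2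
  have hv0 : v ≠ 0 := norm_ne_zero_iff.1 (by rw [hv]; exact one_ne_zero)
  have hJ : Integrable (fun θ : Metric.sphere (0 : E n) 1 =>
      (Real.log b - 1 / 2) + (1 / (2 * b ^ 2)) * |⟪(θ : E n), v⟫| ^ 2) (sphereProb n) :=
    (integrable_const _).add (hI2.const_mul _)
  refine (integral_mono_ae hI hJ ?_).trans ?_
  · filter_upwards [ae_sphereProb_inner_ne_zero hn hv0] with θ hθ
    have hu : 0 < |⟪(θ : E n), v⟫| := abs_pos.2 hθ
    have := Real.log_le_sub_one_of_pos (x := (|⟪(θ : E n), v⟫| / b) ^ 2) (by positivity)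
    rw [Real.log_pow, Real.log_div hu.ne' hb0.ne', div_pow] at this
    push_cast at this
    have e : (1 / (2 * b ^ 2)) * |⟪(θ : E n), v⟫| ^ 2 = (|⟪(θ : E n), v⟫| ^ 2 / b ^ 2) / 2 := by
      field_simp
    rw [e]
    linarith
  · rw [integral_add (integrable_const _) (hI2.const_mul _), integral_const_mul]
    have : 1 / (2 * b ^ 2) * ∫ θ : Metric.sphere (0 : E n) 1, |⟪(θ : E n), v⟫| ^ 2 ∂(sphereProb n)
        ≤ 1 / 2 := by
      rw [div_mul_eq_mul_div, div_le_iff₀ (by positivity)]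
      linarith
    simp
    simp at this
    linarith

/-- Integrability of a measurable kernel from a uniform bound on its integrals. -/
theorem integrable_prod_of_integral_norm_le {X Y : Type*} [MeasurableSpace X] [MeasurableSpace Y]
    {μ : Measure X} {ν : Measure Y} [SFinite μ] [IsFiniteMeasure ν] {f : X × Y → ℝ}
    (hf : Measurable f) (hint : ∀ y, Integrable (fun x => f (x, y)) μ) {M : ℝ}
    (hM : ∀ y, ∫ x, |f (x, y)| ∂μ ≤ M) : Integrable f (μ.prod ν) := by
  rw [integrable_prod_iff' hf.aestronglyMeasurable]
  refine ⟨.of_forall hint, Integrable.mono' (integrable_const M) ?_ (.of_forall fun y => ?_)⟩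
  · exact (StronglyMeasurable.integral_prod_left' (f := fun z => ‖f z‖)
      hf.norm.stronglyMeasurable).aestronglyMeasurable
  · rw [Real.norm_of_nonneg (integral_nonneg fun x => norm_nonneg _)]
    exact hM y

/-- The logarithmic potential of a measure on the sphere. -/
def logPotential {n : ℕ} (μ : Measure (Metric.sphere (0 : E n) 1)) (x : E n) : ℝ :=
  ∫ η : Metric.sphere (0 : E n) 1, Real.log |⟪x, (η : E n)⟫| ∂μ

theorem IsSymmBody.integrable_logPotential {n : ℕ} {K : Set (E n)} {τ : ℝ} (h : IsSymmBody K τ)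
    (μ : Measure (Metric.sphere (0 : E n) 1)) [IsProbabilityMeasure μ] :
    Integrable (logPotential μ) (volume.restrict K) ∧
      volume.real K * Real.log (τ / 49) ≤ ∫ x in K, logPotential μ x := by
  have := h.isFiniteMeasure
  have hmeas : Measurable fun z : E n × Metric.sphere (0 : E n) 1 =>
      Real.log |⟪z.1, (z.2 : E n)⟫| := Real.measurable_log.comp (by fun_prop)
  have hone : ∀ η : Metric.sphere (0 : E n) 1, ‖(η : E n)‖ = 1 := fun η => by simp
  obtain ⟨M, hM⟩ := h.exists_integral_abs_log_le
  have hI : ∀ η : Metric.sphere (0 : E n) 1,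
      Integrable (fun x : E n => Real.log |⟪x, (η : E n)⟫|) (volume.restrict K) :=
    fun η => h.integrable_log (hone η)
  have hK := integrable_prod_of_integral_norm_le (μ := volume.restrict K) (ν := μ) hmeas hI
    (fun η => hM η (hone η))
  refine ⟨hK.integral_prod_left, ?_⟩
  calc volume.real K * Real.log (τ / 49)
      = ∫ _ : Metric.sphere (0 : E n) 1, volume.real K * Real.log (τ / 49) ∂μ := by simp
    _ ≤ ∫ η : Metric.sphere (0 : E n) 1, (∫ x in K, Real.log |⟪x, (η : E n)⟫|) ∂μ :=
      integral_mono (integrable_const _) hK.integral_prod_right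
        fun η => h.le_integral_log (hone η)
    _ = ∫ x in K, logPotential μ x := (integral_integral_swap hK).symm

theorem IsSymmBody.integrable_logPotential_sphere {n : ℕ} (hn : 1 ≤ n) {K : Set (E n)} {τ : ℝ}
    (h : IsSymmBody K τ) (μ : Measure (Metric.sphere (0 : E n) 1)) [IsProbabilityMeasure μ] :
    Integrable (fun θ : Metric.sphere (0 : E n) 1 => logPotential μ θ) (sphereProb n) ∧
      ∫ θ : Metric.sphere (0 : E n) 1, logPotential μ θ ∂(sphereProb n) ≤
        Real.log (3 * √(1 / n)) := by
  have := isProbabilityMeasure_sphereProb hn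
  have hmeas : Measurable fun z : Metric.sphere (0 : E n) 1 × Metric.sphere (0 : E n) 1 =>
      Real.log |⟪(z.1 : E n), (z.2 : E n)⟫| := Real.measurable_log.comp (by fun_prop)
  have hone : ∀ η : Metric.sphere (0 : E n) 1, ‖(η : E n)‖ = 1 := fun η => by simp
  obtain ⟨hIS, M, hM⟩ := h.integrable_log_sphere hn
  have hS := integrable_prod_of_integral_norm_le (ν := μ) hmeas
    (fun η => hIS η (hone η)) (fun η => hM η (hone η))
  refine ⟨hS.integral_prod_left, ?_⟩
  calc ∫ θ : Metric.sphere (0 : E n) 1, logPotential μ θ ∂(sphereProb n)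
      = ∫ η : Metric.sphere (0 : E n) 1, (∫ θ : Metric.sphere (0 : E n) 1,
          Real.log |⟪(θ : E n), (η : E n)⟫| ∂(sphereProb n)) ∂μ := integral_integral_swap hS
    _ ≤ ∫ _ : Metric.sphere (0 : E n) 1, Real.log (3 * √(1 / n)) ∂μ :=
      integral_mono hS.integral_prod_right (integrable_const _)
        fun η => integral_log_sphere_le hn (hone η) (hIS η (hone η))
    _ = Real.log (3 * √(1 / n)) := by simp

/-- The main estimate for the limiting class `SL_0`. -/
theorem IsSymmBody.meanNorm_le_of_zero {n : ℕ} (hn : 1 ≤ n) {K L : Set (E n)} {τ : ℝ}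
    (h : IsSymmBody K τ) (hL : IsSectionZero L) (hKL : K ⊆ L) :
    0 < meanNorm 0 L ∧ τ / 49 * meanNorm 0 L ≤ 3 * √(1 / n) := by
  obtain ⟨-, μ, c, hμ, hg⟩ := hL
  have := isProbabilityMeasure_sphereProb hn
  have := h.isFiniteMeasure
  have hn0 : (0 : ℝ) < n := by exact_mod_cast hn
  have hτ := h.pos
  have hgauge : ∀ x : E n, x ≠ 0 → gauge L x = Real.exp (logPotential μ x + c) :=
    fun x hx => (hg x hx).2.2
  obtain ⟨iK, hK⟩ := h.integrable_logPotential μ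
  obtain ⟨iS, hS⟩ := h.integrable_logPotential_sphere hn μ
  have hc : Real.log (τ / 49) ≤ -c := by
    have h3 : ∫ x in K, logPotential μ x ≤ ∫ _ in K, (-c) := by
      refine integral_mono_ae iK (integrable_const _) ?_
      have hnt : Nonempty (Fin n) := ⟨⟨0, hn⟩⟩
      have hne : ∀ᵐ x : E n ∂(volume.restrict K), x ≠ 0 :=
        ae_restrict_of_ae (Measure.ae_ne volume 0)
      filter_upwards [ae_restrict_mem h.isCompact.measurableSet, hne] with x hx hx0
      have := gauge_le_one_of_mem (hKL hx)
      rw [hgauge x hx0, Real.exp_le_one_iff] at this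
      linarith
    rw [setIntegral_const, smul_eq_mul] at h3
    exact le_of_mul_le_mul_left (hK.trans h3)
      (ENNReal.toReal_pos h.volume_ne_zero h.volume_ne_top)
  have hM0 : meanNorm 0 L = Real.exp
      ((∫ θ : Metric.sphere (0 : E n) 1, logPotential μ θ ∂(sphereProb n)) + c) := by
    rw [meanNorm, if_pos rfl]
    congr 1
    have : ∀ θ : Metric.sphere (0 : E n) 1, Real.log (gauge L θ) = logPotential μ θ + c :=
      fun θ => by rw [hgauge θ (ne_zero_of_mem_unit_sphere θ), Real.log_exp]
    simp_rw [this]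
    rw [integral_add iS (integrable_const _)]
    simp
  rw [hM0]
  refine ⟨Real.exp_pos _, ?_⟩
  have h1 : Real.exp (Real.log (τ / 49)) * Real.exp
      ((∫ θ : Metric.sphere (0 : E n) 1, logPotential μ θ ∂(sphereProb n)) + c) ≤
      Real.exp (Real.log (3 * √(1 / n))) := by
    rw [← Real.exp_add]
    exact Real.exp_le_exp.2 (by linarith)
  rwa [Real.exp_log (by positivity), Real.exp_log (by positivity)] at h1

/-! ### The isotropic constant -/

/-- The unit ball contains a cube. -/
theorem le_volume_closedBall {n : ℕ} (hn : 1 ≤ n) :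
    ENNReal.ofReal ((√n)⁻¹ ^ n) ≤ volume (Metric.closedBall (0 : E n) 1) := by
  have hn0 : (0 : ℝ) < n := by exact_mod_cast hn
  set a := (√(n : ℝ))⁻¹ with ha
  have ha0 : 0 < a := by positivity
  have hsub : (WithLp.ofLp : E n → (Fin n → ℝ)) ⁻¹' Icc (fun _ => -a) (fun _ => a) ⊆
      Metric.closedBall (0 : E n) 1 := by
    intro x hx
    rw [mem_closedBall_zero_iff, ← abs_norm, ← sq_le_one_iff_abs_le_one,
      EuclideanSpace.norm_sq_eq]
    calc ∑ i, ‖x i‖ ^ 2 ≤ ∑ _i : Fin n, a ^ 2 := by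
          refine Finset.sum_le_sum fun i _ => ?_
          have : |x i| ≤ a := abs_le.2 ⟨hx.1 i, hx.2 i⟩
          rw [Real.norm_eq_abs]
          gcongr
      _ = 1 := by
          rw [ha, inv_pow, Real.sq_sqrt hn0.le]
          simp [hn0.ne']
  refine le_trans ?_ (measure_mono hsub)
  rw [(PiLp.volume_preserving_ofLp (Fin n)).measure_preimage measurableSet_Icc.nullMeasurableSet,
    Real.volume_Icc_pi]
  simp only [Finset.prod_const, Finset.card_univ, Fintype.card_fin]
  rw [ENNReal.ofReal_pow ha0.le]
  gcongr
  linarith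

/-- Rescaling a body in isotropic position to volume one yields its isotropic constant. -/
theorem isotropicConstant_le {n : ℕ} {K : Set (E n)} {τ V r : ℝ}
    (hτ : 0 ≤ τ) (hr : 0 < r) (hV : volume K = ENNReal.ofReal V) (hrV : r ^ n * V = 1)
    (hK : ∀ θ : E n, ‖θ‖ = 1 → ∫ x in K, ⟪x, θ⟫ ^ 2 = τ ^ 2 * V) :
    isotropicConstant K ≤ r * τ := by
  refine csInf_le ⟨0, fun x hx => hx.1⟩ ⟨by positivity,
    LinearEquiv.smulOfNeZero ℝ (E n) r hr.ne', ?_, fun θ hθ => ?_⟩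
  · rw [show (LinearEquiv.smulOfNeZero ℝ (E n) r hr.ne' : E n → E n) '' K = r • K from rfl,
      Measure.addHaar_smul, hV, ← ENNReal.ofReal_mul (abs_nonneg _)]
    simp [abs_of_pos hr, hrV]
  · rw [show (LinearEquiv.smulOfNeZero ℝ (E n) r hr.ne' : E n → E n) '' K = r • K from rfl]
    have := Measure.setIntegral_comp_smul_of_pos (volume : Measure (E n))
      (fun x => ⟪x, θ⟫ ^ 2) K hr
    simp only [real_inner_smul_left, mul_pow, finrank_euclideanSpace, Fintype.card_fin,
      integral_const_mul, hK θ hθ, smul_eq_mul] at this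
    rw [eq_comm, inv_mul_eq_iff_eq_mul₀ (by positivity)] at this
    rw [this]
    calc r ^ n * (r ^ 2 * (τ ^ 2 * V)) = (r ^ n * V) * (r * τ) ^ 2 := by ring
      _ = (r * τ) ^ 2 := by rw [hrV, one_mul]

theorem integral_inner_sq_eq {n : ℕ} {K : Set (E n)} {c : ℝ}
    (hc : ∀ θ : E n, ‖θ‖ = 1 → ∫ x in K, ⟪x, θ⟫ ^ 2 = c) (v : E n) :
    ∫ x in K, ⟪x, v⟫ ^ 2 = ‖v‖ ^ 2 * c := by
  rcases eq_or_ne v 0 with rfl | hv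
  · simp
  have hv0 : 0 < ‖v‖ := norm_pos_iff.2 hv
  rw [← hc (‖v‖⁻¹ • v) (by rw [norm_smul, norm_inv, norm_norm, inv_mul_cancel₀ hv0.ne']),
    ← integral_const_mul]
  refine integral_congr_ae (.of_forall fun x => ?_)
  simp only [real_inner_smul_right]
  field_simp

theorem exists_closedBall_subset {n : ℕ} {K : Set (E n)} (hc : Convex ℝ K)
    (hs : ∀ x ∈ K, -x ∈ K) (hi : (interior K).Nonempty) :
    ∃ ε > 0, Metric.closedBall (0 : E n) ε ⊆ K := by
  obtain ⟨x, hx⟩ := hi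
  obtain ⟨ε, hε, hK⟩ := Metric.nhds_basis_closedBall.mem_iff.1 (mem_interior_iff_mem_nhds.1 hx)
  refine ⟨ε, hε, fun y hy => ?_⟩
  have h1 : x + y ∈ K := hK (by simpa using hy)
  have h2 : -(x - y) ∈ K := hs _ (hK (by simpa using hy))
  have := hc.midpoint_mem h1 h2
  convert this using 1
  rw [midpoint_eq_smul_add, show x + y + -(x - y) = (2 : ℝ) • y by rw [two_smul]; abel, smul_smul]
  simp

theorem isSymmBody_of_isotropic {n : ℕ} (hn : 1 ≤ n) {K : Set (E n)} (hK : IsCompact K)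
    (hconv : Convex ℝ K) (hs : ∀ x ∈ K, -x ∈ K) (hi : (interior K).Nonempty) {c : ℝ}
    (hc : ∀ θ : E n, ‖θ‖ = 1 → ∫ x in K, ⟪x, θ⟫ ^ 2 = c) :
    IsSymmBody K √(c / volume.real K) := by
  obtain ⟨ε, hε, hball⟩ := exists_closedBall_subset hconv hs hi
  have hV0 : volume K ≠ 0 :=
    ((Metric.measure_closedBall_pos volume (0 : E n) hε).trans_le (measure_mono hball)).ne'
  have hV : 0 < volume.real K := ENNReal.toReal_pos hV0 hK.measure_ne_top
  have hint : ∀ v : E n, Integrable (fun x => ⟪x, v⟫ ^ 2) (volume.restrict K) := fun v =>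
    (Continuous.continuousOn (by fun_prop)).integrableOn_compact hK
  have hcpos : 0 < c := by
    set e : E n := EuclideanSpace.single ⟨0, hn⟩ 1 with he
    have he1 : ‖e‖ = 1 := by simp [he]
    rw [← hc e he1, integral_pos_iff_support_of_nonneg (fun x => sq_nonneg _) (hint e)]
    rw [Measure.restrict_apply' hK.measurableSet]
    have hmem : (ε / 2) • e ∈ Metric.ball (0 : E n) ε := by
      rw [mem_ball_zero_iff, norm_smul, he1, mul_one, Real.norm_of_nonneg (by positivity)]
      linarith
    have hopen : IsOpen (Function.support (fun x : E n => ⟪x, e⟫ ^ 2) ∩ Metric.ball (0 : E n) ε) :=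
      (Continuous.isOpen_support (by fun_prop)).inter Metric.isOpen_ball
    refine (hopen.measure_pos volume ⟨(ε / 2) • e, ?_, hmem⟩).trans_le (measure_mono ?_)
    · simp [real_inner_smul_left, he1, hε.ne']
    · exact inter_subset_inter_right _ (Metric.ball_subset_closedBall.trans hball)
  refine ⟨hK, hconv, hs, ⟨ε, hε, hball⟩, by positivity, fun v => ?_⟩
  rw [← ofReal_integral_eq_lintegral_ofReal (hint v) (.of_forall fun x => sq_nonneg _),
    integral_inner_sq_eq hc, ← ofReal_measureReal (μ := volume) (s := K) (h := hK.measure_ne_top),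
    ← ENNReal.ofReal_mul (by positivity), mul_pow, Real.sq_sqrt (by positivity)]
  refine ENNReal.ofReal_le_ofReal (le_of_eq ?_)
  field_simp

/-- Monomials span an `n`-dimensional subspace of `L_2`. -/
theorem exists_injective_LpUnit_two (n : ℕ) : ∃ T : E n →ₗ[ℝ] LpUnit 2, Function.Injective T := by
  have hg : ∀ i : Fin n, MemLp (fun t : ℝ => t ^ (i : ℕ)) (ENNReal.ofReal 2)
      (volume.restrict (Icc (0 : ℝ) 1)) := by
    intro i
    refine MemLp.of_bound (Continuous.aestronglyMeasurable (by fun_prop)) 1 ?_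
    filter_upwards [ae_restrict_mem measurableSet_Icc] with t ht
    rw [Real.norm_of_nonneg (pow_nonneg ht.1 _)]
    exact pow_le_one₀ ht.1 ht.2
  let T : E n →ₗ[ℝ] LpUnit 2 :=
    (Fintype.linearCombination ℝ fun i => (hg i).toLp _).comp
      (WithLp.linearEquiv 2 ℝ (Fin n → ℝ)).toLinearMap
  have hT : ∀ x, T x =ᵐ[volume.restrict (Icc (0 : ℝ) 1)] fun t => ∑ i, x i * t ^ (i : ℕ) := by
    intro x
    have e : T x = ∑ i, x i • (hg i).toLp _ := by
      simp [T, Fintype.linearCombination_apply]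
    rw [e]
    filter_upwards [Lp.coeFn_fun_finsetSum Finset.univ fun i => x i • (hg i).toLp _,
      ae_all_iff.2 fun i => Lp.coeFn_smul (x i) ((hg i).toLp _),
      ae_all_iff.2 fun i => (hg i).coeFn_toLp] with t h1 h2 h3
    rw [h1]
    simp [h2, h3]
  refine ⟨T, (injective_iff_map_eq_zero T).2 fun x hx => ?_⟩
  by_contra hne
  set P : Polynomial ℝ := ∑ i : Fin n, Polynomial.monomial (i : ℕ) (x i) with hP
  have hcoef : ∀ i : Fin n, P.coeff i = x i := by
    intro i
    simp [hP, Polynomial.coeff_monomial, Fin.val_inj]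
  have hP0 : P ≠ 0 := by
    intro h0
    refine hne ?_
    ext i
    rw [← hcoef i, h0]
    simp
  have hroots : ∀ᵐ t ∂(volume.restrict (Icc (0 : ℝ) 1)), P.IsRoot t := by
    have h0 := Lp.coeFn_zero ℝ (ENNReal.ofReal 2) (volume.restrict (Icc (0 : ℝ) 1))
    rw [← hx] at h0
    filter_upwards [hT x, h0] with t h1 h2
    rw [h1] at h2
    simpa [hP, Polynomial.IsRoot, Polynomial.eval_finsetSum, Polynomial.eval_monomial] using h2
  have hnot : ∀ᵐ t ∂(volume.restrict (Icc (0 : ℝ) 1)), ¬ P.IsRoot t := by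
    refine ae_restrict_of_ae ?_
    rw [ae_iff]
    simp only [not_not]
    exact (Polynomial.finite_setOfPred_isRoot hP0).measure_zero _
  have : ∀ᵐ t ∂(volume.restrict (Icc (0 : ℝ) 1)), False := by
    filter_upwards [hroots, hnot] with t h1 h2 using h2 h1
  rw [Filter.eventually_false_iff_eq_bot, ae_eq_bot, Measure.restrict_eq_zero] at this
  simp at this

theorem sectionBounds_nonempty {n : ℕ} {K : Set (E n)} (hK : IsCompact K) :
    (sectionBounds K).Nonempty := by
  have : Fact (1 ≤ ENNReal.ofReal 2) := ⟨by simp⟩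
  obtain ⟨T, hT⟩ := exists_injective_LpUnit_two n
  have hcont : Continuous T := T.continuous_of_finiteDimensional
  obtain ⟨B, hB⟩ := hK.exists_bound_of_continuousOn hcont.continuousOn
  set b := (max B 1)⁻¹ with hb
  have hb0 : 0 < b := by positivity
  refine ⟨_, 2, {x | ‖(b • T) x‖ ≤ 1}, by norm_num, Or.inl ⟨by norm_num, b • T, ?_, rfl⟩,
    fun x hx => ?_, rfl⟩
  · intro x y hxy
    exact hT (smul_right_injective _ hb0.ne' hxy)
  · simp only [mem_ofPred_eq, LinearMap.smul_apply]
    rw [norm_smul, Real.norm_of_nonneg hb0.le, hb, inv_mul_le_iff₀ (by positivity), mul_one]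
    exact (hB x hx).trans (le_max_left _ _)

theorem IsSymmBody.meanNorm_le {n : ℕ} (hn : 1 ≤ n) {K L : Set (E n)} {τ p : ℝ}
    (h : IsSymmBody K τ) (hL : IsSection p L) (hKL : K ⊆ L) :
    0 < meanNorm p L ∧ τ / 49 * meanNorm p L ≤ 3 * √(max 1 (min p n) / n) := by
  rcases hL with ⟨hp, hL⟩ | ⟨rfl, hL⟩
  · exact h.meanNorm_le_of_pos hn hp hL hKL
  · have : max 1 (min 0 (n : ℝ)) = 1 := by simp
    rw [this]
    exact h.meanNorm_le_of_zero hn hL hKL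

end Slicing

end

theorem theorem1 :
    ∃ C : ℝ, 0 < C ∧
      ∀ (n : ℕ), 1 ≤ n →
      ∀ (K : ConvexBody (EuclideanSpace ℝ (Fin n))),
        (interior (K : Set (EuclideanSpace ℝ (Fin n)))).Nonempty →
        (∀ x ∈ K, -x ∈ K) →
        Slicing.IsIsotropicPosition (K : Set (EuclideanSpace ℝ (Fin n))) →
        volume (K : Set (EuclideanSpace ℝ (Fin n))) =
          volume (Metric.closedBall (0 : EuclideanSpace ℝ (Fin n)) 1) →
        Slicing.isotropicConstant (K : Set (EuclideanSpace ℝ (Fin n))) ≤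
          C * sInf (Slicing.sectionBounds (K : Set (EuclideanSpace ℝ (Fin n)))) := by
  refine ⟨147, by norm_num, fun n hn K hi hs ⟨c, hc⟩ hvol => ?_⟩
  have hn0 : (0 : ℝ) < n := by exact_mod_cast hn
  have hbody := Slicing.isSymmBody_of_isotropic hn K.isCompact K.convex hs hi hc
  set V := volume.real (K : Set (EuclideanSpace ℝ (Fin n))) with hV
  set τ := √(c / V) with hτ
  have hτ0 : 0 < τ := hbody.pos
  have hVK : volume (K : Set (EuclideanSpace ℝ (Fin n))) = ENNReal.ofReal V :=
    (ofReal_measureReal hbody.volume_ne_top).symm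
  have hV0 : 0 < V := ENNReal.toReal_pos hbody.volume_ne_zero hbody.volume_ne_top
  have hVle : (√n)⁻¹ ^ n ≤ V := by
    have := Slicing.le_volume_closedBall hn
    rw [← hvol, hVK] at this
    exact (ENNReal.ofReal_le_ofReal_iff hV0.le).1 this
  set r := V ^ (-(1 / n) : ℝ) with hr
  have hr0 : 0 < r := by positivity
  have hrV : r ^ n * V = 1 := by
    rw [hr, ← Real.rpow_natCast, ← Real.rpow_mul hV0.le, neg_mul, one_div,
      inv_mul_cancel₀ hn0.ne', Real.rpow_neg_one, inv_mul_cancel₀ hV0.ne']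
  have hrn : r ≤ √n := by
    have h1 : r ^ n * (√n)⁻¹ ^ n ≤ 1 := by
      rw [← hrV]
      gcongr
    rw [← mul_pow, pow_le_one_iff_of_nonneg (by positivity) (by lia), ← div_eq_mul_inv,
      div_le_one (by positivity)] at h1
    exact h1
  have hcV : c = τ ^ 2 * V := by
    have hc0 : 0 ≤ c := by
      rw [← hc (EuclideanSpace.single ⟨0, hn⟩ 1) (by simp)]
      exact integral_nonneg fun x => sq_nonneg _
    rw [hτ, Real.sq_sqrt (by positivity)]
    field_simp
  have hLK := Slicing.isotropicConstant_le hτ0.le hr0 hVK hrV (fun θ hθ => (hc θ hθ).trans hcV)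
  refine hLK.trans ?_
  rw [← div_le_iff₀' (by norm_num)]
  refine le_csInf (Slicing.sectionBounds_nonempty K.isCompact) ?_
  rintro _ ⟨p, L, hp, hL, hKL, rfl⟩
  obtain ⟨hM, hle⟩ := hbody.meanNorm_le hn hL hKL
  rw [le_div_iff₀ hM]
  rw [Real.sqrt_div (by positivity), ← mul_div_assoc, le_div_iff₀ (by positivity)] at hle
  have h0 : 0 ≤ τ / 49 * Slicing.meanNorm p L := by positivity
  have := mul_le_mul_of_nonneg_left hrn h0
  calc r * τ / 147 * Slicing.meanNorm p L
      = τ / 49 * Slicing.meanNorm p L * r / 3 := by ring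
    _ ≤ _ := by linarith
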